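/- Let $G$ be a finite abelian group of order $n$. A subset $A\subseteq G$ is sum-free if there are no $x,y,z\in A$ (not necessarily distinct) with $x+y=z$. Write $\mathrm{SF}(G)$ for the set of all sum-free subsets of $G$, and $\mu(G)$ for the density of the largest sum-free subset of $G$, so that this subset has size $\mu(G)n$. For a prime $p=3k+2$ we say that $G$ is of type I($p$) if $p$ is the least prime factor of $n$ that is congruent to $2$ modulo $3$. Theorem 3. Let $p=3k+2$ be prime, and put $W=1$ if $p=2$ and $W=1/2$ otherwise. For every $\varepsilon>0$ there is $N=N(p,\varepsilon)$ such that every finite abelian group $G$ of type I($p$) and order $n\ge N$ satisfies $$\Bigl|\,|\mathrm{SF}(G)|-W\cdot\#\{g\in G: g\text{ has order }p\}\cdot 2^{\mu(G)n}\Bigr|\le \varepsilon\, W\cdot\#\{g\in G: g\text{ has order }p\}\cdot 2^{\mu(G)n},$$ that is, $|\mathrm{SF}(G)|=W\cdot\#\{\text{elements of order }p\}\cdot2^{\mu(G)n}(1+o_p(1))$; and all but at most $\varepsilon\,2^{\mu(G)n}$ of the sum-free subsets $A$ of $G$ are contained in $\psi^{-1}(\{k+1,\dots,2k+1\})$ for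 some homomorphism $\psi:G\to\mathbb{Z}/p\mathbb{Z}$ (depending on $A$). -/

import Mathlib

/-- `A` is sum-free: `x + y = z` has no solution with `x, y, z ∈ A` (`x = y` is allowed). -/
def IsSumFree {G : Type*} [Add G] (A : Finset G) : Prop :=
  ∀ x ∈ A, ∀ y ∈ A, x + y ∉ A

open Classical in
/-- The family of all sum-free subsets of `G`. -/
noncomputable def sumFreeSets (G : Type*) [Add G] [Fintype G] : Finset (Finset G) :=
  Finset.univ.filter fun A => IsSumFree A

/-- The density of the largest sum-free subset of `G`. -/
noncomputable def sumFreeDensity (G : Type*) [Add G] [Fintype G] : ℝ :=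
  (((sumFreeSets G).sup Finset.card : ℕ) : ℝ) / (Fintype.card G : ℝ)

/-- `p` is the least prime factor of `|G|` that is congruent to `2` modulo `3`. -/
def IsTypeI (p : ℕ) (G : Type*) [Fintype G] : Prop :=
  IsLeast {q : ℕ | q.Prime ∧ q % 3 = 2 ∧ q ∣ Fintype.card G} p

/-- The set of residues `{k + 1, …, 2k + 1}` in `ℤ/pℤ`. -/
def middleResidues (p k : ℕ) : Finset (ZMod p) :=
  (Finset.Icc (k + 1) (2 * k + 1)).image fun j : ℕ => (j : ZMod p)

open Classical in
/-- The number of elements of (exact) order `p` in `G`. -/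
noncomputable def numOrder (p : ℕ) (G : Type*) [AddMonoid G] [Fintype G] : ℕ :=
  (Finset.univ.filter fun g : G => addOrderOf g = p).card

open Classical in
/-- The sum-free subsets of `G` that are contained in no `ψ⁻¹({k + 1, …, 2k + 1})` with
`ψ : G → ℤ/pℤ` a homomorphism. -/
noncomputable def exceptionalSumFreeSets (p k : ℕ) (G : Type*) [AddCommGroup G] [Fintype G] :
    Finset (Finset G) :=
  (sumFreeSets G).filter fun A => ¬ ∃ ψ : G →+ ZMod p, ∀ x ∈ A, ψ x ∈ middleResidues p k

/-!
Let `A` be sum-free in a group of type I(`p`). If `A` has density above `1 / 3` then `A + A` is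
small, so by Kneser's theorem `A` is essentially lifted from a quotient. When the density is close
to the maximum `(k + 1) / p`, the quotient has order `p`, and Vosper's theorem turns the image of
`A` into a dilate of `{k + 1, …, 2k + 1}`: the large sum-free sets are stable. By a graph container
argument all sum-free sets lie in `2 ^ o(n)` sets having `o(n²)` Schur triples, and by triangle
removal each such container is nearly sum-free. Hence all but a negligible proportion of the
sum-free sets are almost contained in some `ψ⁻¹{k + 1, …, 2k + 1}`. Those not fully contained are
rare too: a point `x` outside the preimage `S` forbids one element from each of `Ω(n)` disjoint
pairs `{y, y + x} ⊆ S`. Finally, distinct preimages differ in at least `n / p ^ 2` points, so by the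
Bonferroni inequality their power sets are almost disjoint, and there are `W · #{g : ord g = p}`
preimages because `ψ` and `-ψ` give the same one.
-/

open Finset
open scoped Pointwise

section Kneser

open AddAction (stabilizer)

variable {G : Type*} [AddCommGroup G] {K L : AddSubgroup G}

section Stabilizer

variable [DecidableEq G]

theorem mem_of_le_stabilizer {A : Finset G} (hK : K ≤ stabilizer G A) {a x : G} (ha : a ∈ A)
    (hx : x - a ∈ K) : x ∈ A := by
  simpa using AddAction.mem_stabilizer_finset'.1 (hK hx) ha

theorem le_stabilizer_union {A B : Finset G} (hA : K ≤ stabilizer G A)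
    (hB : K ≤ stabilizer G B) : K ≤ stabilizer G (A ∪ B) := by
  refine fun g hg => AddAction.mem_stabilizer_finset.2 fun x => ?_
  rw [mem_union, mem_union, AddAction.mem_stabilizer_finset.1 (hA hg),
    AddAction.mem_stabilizer_finset.1 (hB hg)]

/-- The weak form of Kneser's bound, with `A` and `B` in place of their hulls. -/
def KneserBound (A B : Finset G) : Prop :=
  #A + #B ≤ #(A + B) + Nat.card (stabilizer G (A + B))

theorem kneserBound_vadd_iff {A B : Finset G} (g : G) :
    KneserBound A (g +ᵥ B) ↔ KneserBound A B := by
  rw [KneserBound, KneserBound, add_vadd_comm, card_vadd_finset, card_vadd_finset,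
    AddAction.stabilizer_vadd_eq_right]

end Stabilizer

variable [Finite G]

/-- The union of the cosets of `K` that meet `A`; in particular `cosetHull K {a}` is the coset
`a + K`. -/
noncomputable def cosetHull (K : AddSubgroup G) (A : Finset G) : Finset G :=
  (Set.toFinite {x | ∃ a ∈ A, x - a ∈ K}).toFinset

theorem mem_cosetHull {A : Finset G} {x : G} : x ∈ cosetHull K A ↔ ∃ a ∈ A, x - a ∈ K := by
  simp [cosetHull]

theorem mem_cosetHull_singleton {a x : G} : x ∈ cosetHull K {a} ↔ x - a ∈ K := by
  simp [mem_cosetHull]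

theorem cosetHull_empty (K : AddSubgroup G) : cosetHull K ∅ = ∅ := by
  simp [cosetHull]

theorem subset_cosetHull (K : AddSubgroup G) (A : Finset G) : A ⊆ cosetHull K A :=
  fun a ha => mem_cosetHull.2 ⟨a, ha, by simp⟩

theorem mem_cosetHull_self (K : AddSubgroup G) (a : G) : a ∈ cosetHull K {a} :=
  subset_cosetHull K {a} (mem_singleton_self a)

theorem cosetHull_mono {A B : Finset G} (hKL : K ≤ L) (hAB : A ⊆ B) :
    cosetHull K A ⊆ cosetHull L B := by
  intro x hx
  obtain ⟨a, ha, h⟩ := mem_cosetHull.1 hx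
  exact mem_cosetHull.2 ⟨a, hAB ha, hKL h⟩

theorem cosetHull_singleton_eq {a b : G} (h : a - b ∈ K) :
    cosetHull K {a} = cosetHull K {b} := by
  ext x
  rw [mem_cosetHull_singleton, mem_cosetHull_singleton, ← sub_add_sub_cancel x a b,
    K.add_mem_cancel_right h]

theorem disjoint_cosetHull_singleton {a b : G} (h : a - b ∉ K) :
    Disjoint (cosetHull K {a}) (cosetHull K {b}) := by
  rw [Finset.disjoint_left]
  intro x hxa hxb
  rw [mem_cosetHull_singleton] at hxa hxb
  exact h (by simpa using K.sub_mem hxb hxa)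

theorem card_cosetHull_singleton (K : AddSubgroup G) (a : G) :
    #(cosetHull K {a}) = Nat.card K := by
  rw [← Nat.card_eq_finsetCard]
  exact Nat.card_congr
    { toFun := fun x => ⟨x - a, mem_cosetHull_singleton.1 x.2⟩
      invFun := fun g => ⟨g + a, mem_cosetHull_singleton.2 (by simp)⟩
      left_inv := fun x => by simp
      right_inv := fun g => by simp }

variable [DecidableEq G]

theorem cosetHull_subset {A B : Finset G} (hK : K ≤ stabilizer G B) (hAB : A ⊆ B) :
    cosetHull K A ⊆ B := by
  intro x hx
  obtain ⟨a, ha, h⟩ := mem_cosetHull.1 hx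
  exact mem_of_le_stabilizer hK (hAB ha) h

theorem le_stabilizer_cosetHull (K : AddSubgroup G) (A : Finset G) :
    K ≤ stabilizer G (cosetHull K A) := by
  refine fun g hg => AddAction.mem_stabilizer_finset'.2 fun x hx => ?_
  obtain ⟨a, ha, h⟩ := mem_cosetHull.1 hx
  exact mem_cosetHull.2 ⟨a, ha, by simpa [add_sub_assoc] using K.add_mem hg h⟩

theorem disjoint_cosetHull_singleton_of_notMem {A : Finset G} (hK : K ≤ stabilizer G A) {x : G}
    (hx : x ∉ A) : Disjoint A (cosetHull K {x}) := by
  rw [Finset.disjoint_left]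
  refine fun a ha hax => hx (mem_of_le_stabilizer hK ha ?_)
  simpa using K.neg_mem (mem_cosetHull_singleton.1 hax)

theorem stabilizer_le_of_subset_cosetHull_singleton {A : Finset G} (hA : A.Nonempty) {a : G}
    (h : A ⊆ cosetHull K {a}) : stabilizer G A ≤ K := by
  intro g hg
  obtain ⟨s, hs⟩ := hA
  have hs' := mem_cosetHull_singleton.1 (h hs)
  have hgs := mem_cosetHull_singleton.1 (h (AddAction.mem_stabilizer_finset'.1 hg hs))
  simpa using K.sub_mem hgs hs'

theorem cosetHull_add_cosetHull {A B : Finset G} (h : K ≤ stabilizer G (A + B)) :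
    cosetHull K A + cosetHull K B = A + B := by
  refine Subset.antisymm ?_ (add_subset_add (subset_cosetHull _ _) (subset_cosetHull _ _))
  intro x hx
  obtain ⟨y, hy, z, hz, rfl⟩ := mem_add.1 hx
  obtain ⟨a, ha, hya⟩ := mem_cosetHull.1 hy
  obtain ⟨b, hb, hzb⟩ := mem_cosetHull.1 hz
  refine mem_of_le_stabilizer h (add_mem_add ha hb) ?_
  simpa [add_sub_add_comm] using K.add_mem hya hzb

theorem add_cosetHull {A B : Finset G} (h : K ≤ stabilizer G (A + B)) :
    A + cosetHull K B = A + B :=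
  Subset.antisymm ((add_subset_add_right (subset_cosetHull _ _)).trans
    (cosetHull_add_cosetHull h).subset) (add_subset_add_left (subset_cosetHull _ _))

theorem cosetHull_singleton_add_subset (K : AddSubgroup G) (a b : G) :
    cosetHull K {a} + cosetHull K {b} ⊆ cosetHull K {a + b} := by
  intro y hy
  obtain ⟨u, hu, v, hv, rfl⟩ := mem_add.1 hy
  rw [mem_cosetHull_singleton, add_sub_add_comm]
  exact K.add_mem (mem_cosetHull_singleton.1 hu) (mem_cosetHull_singleton.1 hv)

theorem card_cosetHull_singleton_inter_vadd {R : Finset G} (hR : L ≤ stabilizer G R) (q : G)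
    {g : G} (hg : g ∈ L) : #(cosetHull K {g + q} ∩ R) = #(cosetHull K {q} ∩ R) := by
  have hcoset : cosetHull K {g + q} = g +ᵥ cosetHull K {q} := by
    ext x
    rw [← Finset.neg_vadd_mem_iff, mem_cosetHull_singleton, mem_cosetHull_singleton, vadd_eq_add]
    congr! 1
    abel
  have hR' : g +ᵥ R = R := hR hg
  calc #(cosetHull K {g + q} ∩ R) = #(g +ᵥ (cosetHull K {q} ∩ R)) := by
        rw [vadd_finset_inter, hcoset, hR']
    _ = #(cosetHull K {q} ∩ R) := card_vadd_finset _ _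

/-- The conclusion of Kneser's theorem for `A` and `B`. -/
def StrongKneserBound (A B : Finset G) : Prop :=
  #(cosetHull (stabilizer G (A + B)) A) + #(cosetHull (stabilizer G (A + B)) B) ≤
    #(A + B) + Nat.card (stabilizer G (A + B))

theorem KneserBound.strong {A B : Finset G}
    (h : KneserBound (cosetHull (stabilizer G (A + B)) A) (cosetHull (stabilizer G (A + B)) B)) :
    StrongKneserBound A B := by
  rwa [KneserBound, cosetHull_add_cosetHull le_rfl] at h

/-- If `q` lies outside a `K`-periodic set `P` and an `L`-periodic set `R`, while its `L`-coset
meets `P` and its `K`-coset meets `R`, then `P` and `R` are far from being complementary. -/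
theorem card_add_card_le_of_crossing {P R U : Finset G}
    (hP : K ≤ stabilizer G P) (hR : L ≤ stabilizer G R) {q : G} (hqP : q ∉ P) (hqR : q ∉ R)
    {g h : G} (hg : g ∈ K) (hh : h ∈ L) (hgR : g + q ∈ R) (hhP : h + q ∈ P)
    (hKU : cosetHull K {q} ⊆ U) (hLU : cosetHull L {q} ⊆ U) :
    Nat.card K + Nat.card L ≤
      #(U \ (P ∪ R)) + #(P ∩ R) + 2 * Nat.card (K ⊓ L : AddSubgroup G) := by
  have row : #(cosetHull K {q} \ R) + #(cosetHull K {h + q} ∩ R) = Nat.card K := by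
    rw [card_cosetHull_singleton_inter_vadd hR q hh, card_sdiff_add_card_inter,
      card_cosetHull_singleton]
  have col : #(cosetHull L {q} \ P) + #(cosetHull L {g + q} ∩ P) = Nat.card L := by
    rw [card_cosetHull_singleton_inter_vadd hP q hg, card_sdiff_add_card_inter,
      card_cosetHull_singleton]
  have outside : (cosetHull K {q} \ R) ∪ (cosetHull L {q} \ P) ⊆ U \ (P ∪ R) := by
    have hqK := (disjoint_cosetHull_singleton_of_notMem hP hqP).symm
    have hqL := (disjoint_cosetHull_singleton_of_notMem hR hqR).symm
    exact union_subset
      (subset_sdiff.2 ⟨sdiff_subset.trans hKU,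
        disjoint_union_right.2 ⟨hqK.mono_left sdiff_subset, sdiff_disjoint⟩⟩)
      (subset_sdiff.2 ⟨sdiff_subset.trans hLU,
        disjoint_union_right.2 ⟨sdiff_disjoint, hqL.mono_left sdiff_subset⟩⟩)
  have inside : (cosetHull K {h + q} ∩ R) ∪ (cosetHull L {g + q} ∩ P) ⊆ P ∩ R := by
    rw [inter_comm P]
    refine union_subset ?_ (inter_subset_inter_right (cosetHull_subset hR (by simpa)))
    rw [inter_comm R]
    exact inter_subset_inter_right (cosetHull_subset hP (by simpa))
  have corner : (cosetHull K {q} \ R) ∩ (cosetHull L {q} \ P) ⊆ cosetHull (K ⊓ L) {q} := by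
    intro x hx
    simp only [mem_inter, mem_sdiff, mem_cosetHull_singleton] at hx ⊢
    exact ⟨hx.1.1, hx.2.1⟩
  have opposite : (cosetHull K {h + q} ∩ R) ∩ (cosetHull L {g + q} ∩ P) ⊆
      cosetHull (K ⊓ L) {g + (h + q)} := by
    intro x hx
    simp only [mem_inter, mem_cosetHull_singleton] at hx ⊢
    refine ⟨?_, ?_⟩
    · simpa [sub_sub, add_comm, add_left_comm] using K.sub_mem hx.1.1 hg
    · simpa [sub_sub, add_comm, add_left_comm] using L.sub_mem hx.2.1 hh
  have := card_le_card outside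
  have := card_le_card inside
  have hcorner := card_le_card corner
  have hopposite := card_le_card opposite
  rw [card_cosetHull_singleton] at hcorner hopposite
  have := card_union_add_card_inter (cosetHull K {q} \ R) (cosetHull L {q} \ P)
  have := card_union_add_card_inter (cosetHull K {h + q} ∩ R) (cosetHull L {g + q} ∩ P)
  omega

/-- A nonempty `K`-periodic part `C` of `A + B` that is large in terms of `A ∩ B` and `A ∪ B`: the
*convergents* of DeVos's proof of Kneser's theorem, which we follow. -/
def IsConvergent (A B C : Finset G) (K : AddSubgroup G) : Prop :=
  C ⊆ A + B ∧ C.Nonempty ∧ K ≤ stabilizer G C ∧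
    #(A ∩ B) + #(cosetHull K (A ∪ B)) ≤ #C + Nat.card K

/-- The sets `A ∩ (a + K)` and `B ∩ (b + K)` occupy so few cosets of `K₁` that no convergent is
obtained by adjoining their sum. -/
def HasLocalDeficit (A B : Finset G) (K K₁ : AddSubgroup G) (a b : G) : Prop :=
  ∀ L ≤ K₁, #(cosetHull K₁ (A ∩ cosetHull K {a})) + #(cosetHull K₁ (B ∩ cosetHull K {b})) +
    Nat.card L + #(cosetHull K (A ∪ B) \ cosetHull L (A ∪ B)) < Nat.card K + Nat.card K₁

theorem HasLocalDeficit.symm {A B : Finset G} {K₁ : AddSubgroup G} {a b : G}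
    (h : HasLocalDeficit A B K K₁ a b) : HasLocalDeficit B A K K₁ b a := fun L hL => by
  rw [union_comm B A, add_comm #(cosetHull K₁ (B ∩ _))]
  exact h L hL

theorem IsConvergent.card_add_lt_of_forall_le {A B C D : Finset G}
    (hC : IsConvergent A B C K)
    (hmin : ∀ C' L, IsConvergent A B C' L → Nat.card K ≤ Nat.card L) (hDAB : D ⊆ A + B)
    (hCD : Disjoint C D) (hLK : L ≤ K) (hcard : Nat.card L < Nat.card K)
    (hLD : L ≤ stabilizer G D) :
    #D + Nat.card L + #(cosetHull K (A ∪ B) \ cosetHull L (A ∪ B)) < Nat.card K := by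
  obtain ⟨hCAB, hCne, hCper, hCcard⟩ := hC
  have hbig : #(C ∪ D) + Nat.card L < #(A ∩ B) + #(cosetHull L (A ∪ B)) := by
    by_contra! hle
    refine (hmin (C ∪ D) L ⟨union_subset hCAB hDAB, hCne.mono subset_union_left, ?_, hle⟩).not_gt
      hcard
    exact le_stabilizer_union (hLK.trans hCper) hLD
  rw [card_union_of_disjoint hCD] at hbig
  have := card_sdiff_add_card_eq_card (cosetHull_mono hLK (Subset.refl (A ∪ B)))
  omega

theorem IsConvergent.exists_hasLocalDeficit {A B C : Finset G}
    (hC : IsConvergent A B C K)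
    (hmin : ∀ C' L, IsConvergent A B C' L → Nat.card K ≤ Nat.card L)
    (ih : ∀ A' B' : Finset G, #(A' + B') < #(A + B) → StrongKneserBound A' B')
    {a b x : G} (hx : x - (a + b) ∈ K) (hxAB : x ∉ A + B)
    (hA : (A ∩ cosetHull K {a}).Nonempty) (hB : (B ∩ cosetHull K {b}).Nonempty) :
    ∃ K₁ ≤ K, HasLocalDeficit A B K K₁ a b := by
  set A' := A ∩ cosetHull K {a}
  set B' := B ∩ cosetHull K {b}
  have hsubAB : A' + B' ⊆ A + B := add_subset_add inter_subset_left inter_subset_left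
  have hsubK : A' + B' ⊆ cosetHull K {x} := by
    rw [cosetHull_singleton_eq hx]
    exact (add_subset_add inter_subset_right inter_subset_right).trans
      (cosetHull_singleton_add_subset K a b)
  have hdisj : Disjoint C (A' + B') :=
    (disjoint_cosetHull_singleton_of_notMem hC.2.2.1 fun h => hxAB (hC.1 h)).mono_right hsubK
  have hlt : #(A' + B') < #(A + B) := by
    have hsub := card_le_card (union_subset hC.1 hsubAB)
    rw [card_union_of_disjoint hdisj] at hsub
    have := hC.2.1.card_pos
    omega
  have hle : stabilizer G (A' + B') ≤ K :=
    stabilizer_le_of_subset_cosetHull_singleton (hA.add hB) hsubK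
  have hcard : Nat.card (stabilizer G (A' + B')) < Nat.card K := by
    by_contra! hge
    have heq := AddSubgroup.eq_of_le_of_card_ge hle hge
    obtain ⟨s, hs⟩ := hA.add hB
    refine hxAB (hsubAB (mem_of_le_stabilizer heq.ge hs ?_))
    simpa using K.neg_mem (mem_cosetHull_singleton.1 (hsubK hs))
  refine ⟨_, hle, fun L hL => ?_⟩
  have hnew := hC.card_add_lt_of_forall_le hmin hsubAB hdisj (hL.trans hle)
    ((AddSubgroup.card_le_of_le hL).trans_lt hcard) hL
  have hkneser : #(cosetHull _ A') + #(cosetHull _ B') ≤ _ := ih A' B' hlt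
  change #(cosetHull _ A') + #(cosetHull _ B') + _ + _ < _
  omega

theorem cosetHull_inter_coset_subset {K₁ : AddSubgroup G} (A : Finset G) (a : G)
    (h : K₁ ≤ K) : cosetHull K₁ (A ∩ cosetHull K {a}) ⊆ cosetHull K {a} :=
  cosetHull_subset (h.trans (le_stabilizer_cosetHull K {a})) inter_subset_right

theorem coset_sdiff_union_subset {K₁ K₂ : AddSubgroup G} (A B : Finset G) (a : G)
    (hLK : L ≤ K) (h₁ : L ≤ K₁) (h₂ : L ≤ K₂) :
    cosetHull K {a} \ (cosetHull K₁ (A ∩ cosetHull K {a}) ∪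
      cosetHull K₂ (B ∩ cosetHull K {a})) ⊆ cosetHull K {a} \ cosetHull L (A ∪ B) := by
  intro x hx
  obtain ⟨hxU, hx⟩ := mem_sdiff.1 hx
  refine mem_sdiff.2 ⟨hxU, fun hxL => hx ?_⟩
  obtain ⟨d, hd, hxd⟩ := mem_cosetHull.1 hxL
  have hdU : d ∈ cosetHull K {a} := by
    rw [mem_cosetHull_singleton] at hxU ⊢
    simpa using K.sub_mem hxU (hLK hxd)
  rcases mem_union.1 hd with hd | hd
  · exact mem_union_left _ (mem_cosetHull.2 ⟨d, mem_inter.2 ⟨hd, hdU⟩, h₁ hxd⟩)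
  · exact mem_union_right _ (mem_cosetHull.2 ⟨d, mem_inter.2 ⟨hd, hdU⟩, h₂ hxd⟩)

theorem card_le_card_coset_sdiff_add {K₁ : AddSubgroup G} (A B : Finset G) (a : G) (h : K₁ ≤ K) :
    Nat.card K ≤ #(cosetHull K {a} \ cosetHull K₁ (A ∪ B)) +
      #(cosetHull K₁ (A ∩ cosetHull K {a})) +
      #(cosetHull K₁ (B ∩ cosetHull K {a}) \ cosetHull K₁ (A ∩ cosetHull K {a})) := by
  have hmiss := card_le_card (coset_sdiff_union_subset A B a h le_rfl le_rfl)
  have hunion := le_card_sdiff (cosetHull K₁ (A ∩ cosetHull K {a}) ∪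
      cosetHull K₁ (B ∩ cosetHull K {a})) (cosetHull K {a})
  have hsdiff := card_sdiff_add_card (cosetHull K₁ (B ∩ cosetHull K {a}))
    (cosetHull K₁ (A ∩ cosetHull K {a}))
  rw [card_cosetHull_singleton] at hunion
  rw [union_comm] at hsdiff
  omega

theorem card_le_two_mul_card_coset_sdiff_add {K₁ : AddSubgroup G} (K₂ : AddSubgroup G)
    (A B : Finset G) (a : G) (h₁ : K₁ ≤ K) :
    Nat.card K ≤ 2 * #(cosetHull K {a} \ cosetHull (K₁ ⊓ K₂) (A ∪ B)) +
      #(cosetHull K₁ (A ∩ cosetHull K {a})) + #(cosetHull K₂ (B ∩ cosetHull K {a})) := by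
  have hmiss := card_le_card (coset_sdiff_union_subset (L := K₁ ⊓ K₂) A B a
    (inf_le_left.trans h₁) inf_le_left inf_le_right)
  have hunion := le_card_sdiff (cosetHull K₁ (A ∩ cosetHull K {a}) ∪
      cosetHull K₂ (B ∩ cosetHull K {a})) (cosetHull K {a})
  have := card_union_le (cosetHull K₁ (A ∩ cosetHull K {a})) (cosetHull K₂ (B ∩ cosetHull K {a}))
  rw [card_cosetHull_singleton] at hunion
  omega

theorem card_add_le_two_mul_card_coset_sdiff_add {K₁ K₂ : AddSubgroup G} (A B : Finset G) (a : G)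
    (h₁ : K₁ ≤ K) (h₂ : K₂ ≤ K)
    (hlt : Nat.card K <
      #(cosetHull K₁ (B ∩ cosetHull K {a}) \ cosetHull K₁ (A ∩ cosetHull K {a})) +
      #(cosetHull K₂ (A ∩ cosetHull K {a}) \ cosetHull K₂ (B ∩ cosetHull K {a}))) :
    Nat.card K + Nat.card K₁ + Nat.card K₂ ≤
      2 * #(cosetHull K {a} \ cosetHull (K₁ ⊓ K₂) (A ∪ B)) +
      #(cosetHull K₁ (A ∩ cosetHull K {a})) + #(cosetHull K₂ (B ∩ cosetHull K {a})) +
      2 * Nat.card (K₁ ⊓ K₂ : AddSubgroup G) := by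
  set U := cosetHull K {a}
  set P := cosetHull K₁ (A ∩ U)
  set R := cosetHull K₂ (B ∩ U)
  have hPU : P ⊆ U := cosetHull_inter_coset_subset A a h₁
  have hRU : R ⊆ U := cosetHull_inter_coset_subset B a h₂
  have hBU : cosetHull K₁ (B ∩ U) ⊆ U := cosetHull_inter_coset_subset B a h₁
  have hAU : cosetHull K₂ (A ∩ U) ⊆ U := cosetHull_inter_coset_subset A a h₂
  have hUcard : #U = Nat.card K := card_cosetHull_singleton K a
  obtain ⟨q, hq⟩ := inter_nonempty_of_card_lt_card_add_card (sdiff_subset.trans hBU)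
    (sdiff_subset.trans hAU) (hUcard ▸ hlt)
  simp only [mem_inter, mem_sdiff] at hq
  obtain ⟨⟨hqB, hqP⟩, hqA, hqR⟩ := hq
  obtain ⟨b', hb', hb⟩ := mem_cosetHull.1 hqB
  obtain ⟨a', ha', ha⟩ := mem_cosetHull.1 hqA
  have hUq : cosetHull K {q} = U := cosetHull_singleton_eq (mem_cosetHull_singleton.1 (hBU hqB))
  have hcross := card_add_card_le_of_crossing (U := U) (le_stabilizer_cosetHull K₁ (A ∩ U))
    (le_stabilizer_cosetHull K₂ (B ∩ U)) hqP hqR (K₁.neg_mem hb) (K₂.neg_mem ha)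
    (by simpa using subset_cosetHull K₂ _ hb') (by simpa using subset_cosetHull K₁ _ ha')
    (hUq ▸ cosetHull_mono h₁ le_rfl) (hUq ▸ cosetHull_mono h₂ le_rfl)
  have hmiss := card_le_card (coset_sdiff_union_subset (L := K₁ ⊓ K₂) A B a
    (inf_le_left.trans h₁) inf_le_left inf_le_right)
  change _ ≤ #(U \ (P ∪ R)) + #(P ∩ R) + _ at hcross
  change #(U \ (P ∪ R)) ≤ #(U \ cosetHull (K₁ ⊓ K₂) (A ∪ B)) at hmiss
  have := card_sdiff_add_card_eq_card (union_subset hPU hRU)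
  have := card_union_add_card_inter P R
  omega

theorem card_coset_sdiff_le {A B : Finset G} {a : G} (ha : a ∈ A ∪ B) (L : AddSubgroup G) :
    #(cosetHull K {a} \ cosetHull L (A ∪ B)) ≤
      #(cosetHull K (A ∪ B) \ cosetHull L (A ∪ B)) :=
  card_le_card (sdiff_subset_sdiff (cosetHull_mono le_rfl (singleton_subset_iff.2 ha)) le_rfl)

theorem card_coset_sdiff_add_card_coset_sdiff_le {A B : Finset G} {a b : G} (ha : a ∈ A ∪ B)
    (hb : b ∈ A ∪ B) (hab : a - b ∉ K) (L : AddSubgroup G) :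
    #(cosetHull K {a} \ cosetHull L (A ∪ B)) + #(cosetHull K {b} \ cosetHull L (A ∪ B)) ≤
      #(cosetHull K (A ∪ B) \ cosetHull L (A ∪ B)) := by
  rw [← card_union_of_disjoint
    ((disjoint_cosetHull_singleton hab).mono sdiff_subset sdiff_subset)]
  exact card_le_card (union_subset
    (sdiff_subset_sdiff (cosetHull_mono le_rfl (singleton_subset_iff.2 ha)) le_rfl)
    (sdiff_subset_sdiff (cosetHull_mono le_rfl (singleton_subset_iff.2 hb)) le_rfl))

theorem HasLocalDeficit.sub_notMem {A B : Finset G} {K₁ : AddSubgroup G} {a b : G}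
    (h : HasLocalDeficit A B K K₁ a b) (hK₁ : K₁ ≤ K) (ha : a ∈ A) : a - b ∉ K := by
  intro hab
  have hdef := h K₁ le_rfl
  rw [← cosetHull_singleton_eq hab] at hdef
  have := card_le_card_coset_sdiff_add A B a hK₁
  have := card_coset_sdiff_le (K := K) (mem_union_left B ha) K₁
  have := card_le_card (sdiff_subset (s := cosetHull K₁ (B ∩ cosetHull K {a}))
    (t := cosetHull K₁ (A ∩ cosetHull K {a})))
  omega

theorem HasLocalDeficit.inter_coset_nonempty {A B : Finset G} {K₁ : AddSubgroup G} {a b : G}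
    (h : HasLocalDeficit A B K K₁ a b) (hK₁ : K₁ ≤ K) (ha : a ∈ A) :
    (B ∩ cosetHull K {a}).Nonempty := by
  by_contra! hempty
  have hcard := card_le_card_coset_sdiff_add A B a hK₁
  rw [hempty, cosetHull_empty, empty_sdiff, card_empty] at hcard
  have := card_coset_sdiff_le (K := K) (mem_union_left B ha) K₁
  have := h K₁ le_rfl
  omega

theorem HasLocalDeficit.not_swap {A B : Finset G} {K₁ K₂ : AddSubgroup G} {a b : G}
    (h₁ : HasLocalDeficit A B K K₁ a b) (hK₁ : K₁ ≤ K) (hK₂ : K₂ ≤ K) (ha : a ∈ A) (hb : b ∈ B) :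
    ¬ HasLocalDeficit A B K K₂ b a := by
  intro h₂
  have miss := card_coset_sdiff_add_card_coset_sdiff_le (mem_union_left B ha)
    (mem_union_right A hb) (h₁.sub_notMem hK₁ ha)
  have boundU₁ := card_le_card_coset_sdiff_add A B a hK₁
  have boundV₁ := card_le_card_coset_sdiff_add B A b hK₁
  have boundU₂ := card_le_card_coset_sdiff_add B A a hK₂
  have boundV₂ := card_le_card_coset_sdiff_add A B b hK₂
  have boundU := card_le_two_mul_card_coset_sdiff_add K₂ A B a hK₁
  have boundV := card_le_two_mul_card_coset_sdiff_add K₂ B A b hK₁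
  have crossU := card_add_le_two_mul_card_coset_sdiff_add A B a hK₁ hK₂
  have crossV := card_add_le_two_mul_card_coset_sdiff_add B A b hK₁ hK₂
  rw [union_comm B A] at boundV₁ boundU₂ boundV crossV
  have miss₁ := miss K₁
  have miss₂ := miss K₂
  have miss₁₂ := miss (K₁ ⊓ K₂)
  have deficit₁ := h₁ K₁ le_rfl
  have deficit₂ := h₂ K₂ le_rfl
  have deficit₁₂ := h₁ (K₁ ⊓ K₂) inf_le_left
  have deficit₂₁ := h₂ (K₁ ⊓ K₂) inf_le_right
  omega

theorem IsConvergent.le_stabilizer_add {A B C : Finset G} (hC : IsConvergent A B C K)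
    (hmin : ∀ C' L, IsConvergent A B C' L → Nat.card K ≤ Nat.card L)
    (ih : ∀ A' B' : Finset G, #(A' + B') < #(A + B) → StrongKneserBound A' B') :
    K ≤ stabilizer G (A + B) := by
  refine fun g hg => AddAction.mem_stabilizer_finset'.2 fun y hy => ?_
  by_contra hgy
  obtain ⟨a, ha, b, hb, rfl⟩ := mem_add.1 hy
  obtain ⟨K₁, hK₁, h₁⟩ := hC.exists_hasLocalDeficit hmin ih (by simpa) hgy
    ⟨a, mem_inter.2 ⟨ha, mem_cosetHull_self K a⟩⟩ ⟨b, mem_inter.2 ⟨hb, mem_cosetHull_self K b⟩⟩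
  obtain ⟨K₂, hK₂, h₂⟩ := hC.exists_hasLocalDeficit hmin ih (a := b) (b := a) (x := g + (a + b))
    (by simpa [add_comm b a]) hgy (h₁.symm.inter_coset_nonempty hK₁ hb)
    (h₁.inter_coset_nonempty hK₁ ha)
  exact h₁.not_swap hK₁ hK₂ ha hb h₂

theorem exists_isConvergent {A B : Finset G} (hne : (A ∩ B).Nonempty) (hAB : ¬ A ⊆ B)
    (ih : ∀ A' B' : Finset G, #(A' + B') ≤ #(A + B) → #A' < #A → KneserBound A' B') :
    ∃ C K, IsConvergent A B C K := by
  have hlt : #(A ∩ B) < #A :=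
    card_lt_card (inter_subset_left.ssubset_of_ne fun h => hAB (inter_eq_left.1 h))
  have hne' : (A ∪ B).Nonempty := hne.mono (inter_subset_left.trans subset_union_left)
  have hsub : (A ∩ B) + (A ∪ B) ⊆ A + B := inter_add_union_subset
  have hsum := add_cosetHull (le_refl (stabilizer G ((A ∩ B) + (A ∪ B))))
  have hbound := ih (A ∩ B) (cosetHull (stabilizer G ((A ∩ B) + (A ∪ B))) (A ∪ B))
    (by rw [hsum]; exact card_le_card hsub) hlt
  rw [KneserBound, hsum] at hbound
  exact ⟨(A ∩ B) + (A ∪ B), _, hsub, hne.add hne', le_rfl, hbound⟩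

theorem kneserBound_of_inter {A B : Finset G} (hne : (A ∩ B).Nonempty) (hAB : ¬ A ⊆ B)
    (ih : ∀ A' B' : Finset G, #(A' + B') < #(A + B) → KneserBound A' B')
    (ih' : ∀ A' B' : Finset G, #(A' + B') ≤ #(A + B) → #A' < #A → KneserBound A' B') :
    KneserBound A B := by
  classical
  have hconv : ∃ m, ∃ C K, IsConvergent A B C K ∧ Nat.card K = m := by
    obtain ⟨C, K, h⟩ := exists_isConvergent hne hAB ih'
    exact ⟨_, C, K, h, rfl⟩
  obtain ⟨C, K, hC, hK⟩ := Nat.find_spec hconv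
  have hmin : ∀ C' L, IsConvergent A B C' L → Nat.card K ≤ Nat.card L :=
    fun C' L h => hK ▸ Nat.find_min' hconv ⟨C', L, h, rfl⟩
  have hper := AddSubgroup.card_le_of_le <| hC.le_stabilizer_add hmin fun A' B' h =>
    KneserBound.strong <| ih _ _ (by rwa [cosetHull_add_cosetHull le_rfl])
  have := card_le_card hC.1
  have := hC.2.2.2
  have := card_le_card (subset_cosetHull K (A ∪ B))
  have := card_union_add_card_inter A B
  rw [KneserBound]
  omega

/-- Here `A` lies in a single coset of the stabilizer of `B`. -/
theorem kneserBound_of_forall_subset {A B : Finset G} (hA : A.Nonempty)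
    (h : ∀ g : G, (A ∩ (g +ᵥ B)).Nonempty → A ⊆ g +ᵥ B) : KneserBound A B := by
  have hshift : ∀ a ∈ A, ∀ a' ∈ A, a' - a ∈ stabilizer G B := by
    refine fun a ha a' ha' => AddAction.mem_stabilizer_finset'.2 fun b hb => ?_
    have hmem : a' ∈ (a - b) +ᵥ B :=
      h (a - b) ⟨a, mem_inter.2 ⟨ha, mem_vadd_finset.2 ⟨b, hb, by simp⟩⟩⟩ ha'
    obtain ⟨c, hc, rfl⟩ := mem_vadd_finset.1 hmem
    simpa [sub_add_eq_add_sub, add_sub_assoc, add_comm] using hc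
  obtain ⟨a, ha⟩ := hA
  have hsum : A + B = a +ᵥ B := by
    refine Subset.antisymm (fun y hy => ?_) fun y hy => ?_
    · obtain ⟨a', ha', b, hb, rfl⟩ := mem_add.1 hy
      refine mem_vadd_finset.2 ⟨a' - a + b, mem_of_le_stabilizer (K := stabilizer G B) le_rfl hb ?_,
        by simp [← add_assoc]⟩
      simpa using hshift a ha a' ha'
    · obtain ⟨b, hb, rfl⟩ := mem_vadd_finset.1 hy
      exact add_mem_add ha hb
  have hcard : #A ≤ Nat.card (stabilizer G B) := by
    rw [← card_cosetHull_singleton _ a]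
    exact card_le_card fun a' ha' => mem_cosetHull_singleton.2 (hshift a ha a' ha')
  rw [KneserBound, hsum, card_vadd_finset, AddAction.stabilizer_vadd_eq_right]
  omega

theorem kneserBound (A B : Finset G) : KneserBound A B := by
  rcases A.eq_empty_or_nonempty with rfl | hA
  · rw [KneserBound, empty_add, AddAction.stabilizer_finset_empty, AddSubgroup.card_top,
      card_empty, zero_add, zero_add, ← Nat.card_eq_finsetCard]
    exact Finite.card_subtype_le (· ∈ B)
  by_cases h : ∀ g : G, (A ∩ (g +ᵥ B)).Nonempty → A ⊆ g +ᵥ B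
  · exact kneserBound_of_forall_subset hA h
  · push Not at h
    obtain ⟨g, hne, hsub⟩ := h
    have hcard : #(A + (g +ᵥ B)) = #(A + B) := by rw [add_vadd_comm, card_vadd_finset]
    refine (kneserBound_vadd_iff g).1 (kneserBound_of_inter hne hsub
      (fun A' B' hlt => ?_) fun A' B' hle hlt => ?_)
    · have : #(A' + B') < #(A + B) := hcard ▸ hlt
      exact kneserBound A' B'
    · have : #(A' + B') ≤ #(A + B) ∧ #A' < #A := ⟨hcard ▸ hle, hlt⟩
      exact kneserBound A' B'
termination_by (#(A + B), #A)
decreasing_by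
  · exact Prod.Lex.left _ _ this
  · rcases this.1.lt_or_eq with h | h
    · exact Prod.Lex.left _ _ h
    · exact h ▸ Prod.Lex.right _ this.2

theorem kneser (A B : Finset G) :
    #(cosetHull (stabilizer G (A + B)) A) + #(cosetHull (stabilizer G (A + B)) B) ≤
      #(A + B) + Nat.card (stabilizer G (A + B)) :=
  KneserBound.strong <| kneserBound _ _

end Kneser

section Vosper

section AddCommGroup

variable {G : Type*} [AddCommGroup G] [DecidableEq G] {d e : G} {A B S : Finset G}

/-- At most one element of `d + S` lies outside `S`. In `ℤ/pℤ`, for `d ≠ 0`, this encodes without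
endpoints that `S` is an arithmetic progression with common difference `d`. -/
def IsProgressionWithStep (d : G) (S : Finset G) : Prop :=
  #((d +ᵥ S) \ S) ≤ 1

theorem isProgressionWithStep_pair (x y : G) : IsProgressionWithStep (y - x) {x, y} := by
  refine (card_le_card (t := {y - x + y}) fun z hz => ?_).trans_eq (card_singleton _)
  simp only [mem_sdiff, mem_vadd_finset, mem_insert, mem_singleton, vadd_eq_add] at hz ⊢
  obtain ⟨⟨w, rfl | rfl, rfl⟩, hz⟩ := hz
  · simp at hz
  · rfl

theorem card_vadd_finset_neg_sdiff_neg (d : G) (S : Finset G) :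
    #((d +ᵥ -S) \ -S) = #((d +ᵥ S) \ S) := by
  calc #((d +ᵥ -S) \ -S) = #(-(-d +ᵥ ((d +ᵥ -S) \ -S))) := by rw [card_neg, card_vadd_finset]
    _ = #(S \ (d +ᵥ S)) := by
      congr 1
      ext x
      simp [mem_neg', ← neg_vadd_mem_iff, vadd_eq_add, add_comm]
    _ = #((d +ᵥ S) \ S) := card_sdiff_comm (card_vadd_finset d S).symm

theorem IsProgressionWithStep.neg (h : IsProgressionWithStep d S) :
    IsProgressionWithStep d (-S) :=
  (card_vadd_finset_neg_sdiff_neg d S).trans_le h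

theorem card_inter_neg_vadd_add_card_vadd_sdiff (d : G) (S : Finset G) :
    #(S ∩ (-d +ᵥ S)) + #((d +ᵥ S) \ S) = #S := by
  rw [← card_vadd_finset d (S ∩ _), vadd_finset_inter, vadd_neg_vadd, card_inter_add_card_sdiff,
    card_vadd_finset]

theorem union_vadd_add_inter_neg_vadd_subset (d : G) (A B : Finset G) :
    (A ∪ (d +ᵥ A)) + (B ∩ (-d +ᵥ B)) ⊆ A + B := by
  refine union_add_inter_subset_union.trans (union_subset Subset.rfl ?_)
  rw [add_vadd_comm, vadd_add_assoc, neg_vadd_vadd]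

theorem compl_add_add_neg_subset [Fintype G] (A B : Finset G) : (A + B)ᶜ + -A ⊆ Bᶜ := by
  refine add_subset_iff.2 fun x hx y hy => mem_compl.2 fun hB => mem_compl.1 hx ?_
  simpa using add_mem_add (mem_neg'.1 hy) hB

theorem union_vadd_add_singleton_subset {b : G} (hbB : b ∈ B) (hbA : e + b ∈ A) :
    (A ∪ (e +ᵥ B)) + {b} ⊆ A + B := by
  rw [union_add]
  refine union_subset (add_subset_add_left (singleton_subset_iff.2 hbB)) ?_
  rw [vadd_add_assoc, add_comm, ← vadd_add_assoc, vadd_finset_singleton]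
  exact add_subset_add_right (singleton_subset_iff.2 hbA)

theorem union_vadd_sdiff_of_inter_neg_vadd_eq_singleton {b : G} (h : B ∩ (-e +ᵥ A) = {b}) :
    (A ∪ (e +ᵥ B)) \ A = e +ᵥ B.erase b := by
  have hA : (e +ᵥ B) ∩ A = e +ᵥ {b} := by rw [← h, vadd_finset_inter, vadd_neg_vadd]
  rw [union_sdiff_left, ← sdiff_inter_self_left, hA, ← vadd_finset_sdiff, sdiff_singleton_eq_erase]

end AddCommGroup

variable {p : ℕ} [Fact p.Prime] {d e : ZMod p} {A B : Finset (ZMod p)}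

theorem card_add_card_le_of_card_add_lt (hA : A.Nonempty) (hB : B.Nonempty)
    (h : #(A + B) < p) : #A + #B ≤ #(A + B) + 1 := by
  have := ZMod.cauchy_davenport Fact.out hA hB
  omega

theorem IsProgressionWithStep.of_add (hA : A.Nonempty) (hB : 2 ≤ #B)
    (h : IsProgressionWithStep d B) (hAB : #(A + B) + 1 ≤ #A + #B) (hp : #(A + B) < p) :
    IsProgressionWithStep d A := by
  unfold IsProgressionWithStep at h ⊢
  have hB' := card_inter_neg_vadd_add_card_vadd_sdiff d B
  have hA' := card_sdiff_add_card (d +ᵥ A) A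
  have hle := card_le_card (union_vadd_add_inter_neg_vadd_subset d A B)
  have := card_add_card_le_of_card_add_lt (A := A ∪ (d +ᵥ A)) (B := B ∩ (-d +ᵥ B))
    (hA.mono subset_union_left) (card_pos.1 (by omega)) (by omega)
  rw [union_comm] at hA'
  omega

theorem card_compl_add_neg (hB : B.Nonempty) (hAB : #(A + B) + 1 ≤ #A + #B) :
    #((A + B)ᶜ + -A) + 1 ≤ #(A + B)ᶜ + #(-A) ∧ #((A + B)ᶜ + -A) < p := by
  have hle := card_le_card (compl_add_add_neg_subset A B)
  have hpos := hB.card_pos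
  have hBp := card_le_univ B
  have hABp := card_le_univ (A + B)
  simp only [card_compl, card_neg, ZMod.card] at *
  omega

theorem IsProgressionWithStep.compl_add (hB : B.Nonempty) (hA : 2 ≤ #A)
    (hAB : #(A + B) + 1 ≤ #A + #B) (hp : #(A + B) < p) (h : IsProgressionWithStep d A) :
    IsProgressionWithStep d (A + B)ᶜ := by
  obtain ⟨hle, hlt⟩ := card_compl_add_neg hB hAB
  refine .of_add ?_ (by rwa [card_neg]) h.neg hle hlt
  rw [← card_pos, card_compl, ZMod.card]
  omega

theorem IsProgressionWithStep.of_compl_add (hA : A.Nonempty) (hB : B.Nonempty)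
    (hAB : #(A + B) + 1 ≤ #A + #B) (hp : #(A + B) + 2 ≤ p)
    (h : IsProgressionWithStep d (A + B)ᶜ) : IsProgressionWithStep d A := by
  obtain ⟨hle, hlt⟩ := card_compl_add_neg hB hAB
  rw [add_comm (_ ᶜ)] at hle hlt
  rw [← neg_neg A]
  refine (IsProgressionWithStep.of_add hA.neg ?_ h (by omega) hlt).neg
  rw [card_compl, ZMod.card]
  omega

theorem eq_of_vadd_finset_eq {Z : Finset (ZMod p)} (hZ : Z.Nonempty) (hZp : #Z < p)
    (h : d +ᵥ Z = e +ᵥ Z) : d = e := by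
  have hsum (f : ZMod p) : ∑ z ∈ f +ᵥ Z, z = #Z * f + ∑ z ∈ Z, z := by
    rw [← image_vadd, sum_image (AddAction.injective f).injOn]
    rw [← nsmul_eq_mul, ← sum_const, ← sum_add_distrib]
    rfl
  have hmul : (#Z : ZMod p) * d = #Z * e := by
    simpa [hsum] using congrArg (fun S : Finset (ZMod p) => ∑ z ∈ S, z) h
  refine mul_left_cancel₀ ?_ hmul
  rw [Ne, ZMod.natCast_eq_zero_iff]
  exact fun hd => (Nat.le_of_dvd hZ.card_pos hd).not_gt hZp

theorem card_filter_vadd_subset_le (hB : B.Nonempty) (hA : #A < p) :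
    #{e : ZMod p | e +ᵥ B ⊆ A} ≤ #A + 1 - #B := by
  set X : Finset (ZMod p) := {e | e +ᵥ B ⊆ A}
  obtain hX | hX := X.eq_empty_or_nonempty
  · simp [hX]
  have hXB : X + B ⊆ A :=
    add_subset_iff.2 fun e he b hb => (mem_filter.1 he).2 (vadd_mem_vadd_finset hb)
  have hle := card_le_card hXB
  have := card_add_card_le_of_card_add_lt hX hB (hle.trans_lt hA)
  omega

-- Both unions equal `A + B - b`, and the shift can be read off the part `e + (B \ {b})` of the
-- union that lies outside `A`.
theorem eq_of_inter_neg_vadd_eq_singleton {b : ZMod p} (hB : 2 ≤ #B) (hBp : #B ≤ p)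
    (hAB : #(A + B) + 1 ≤ #A + #B) (hd : B ∩ (-d +ᵥ A) = {b}) (he : B ∩ (-e +ᵥ A) = {b}) :
    d = e := by
  have union_eq {f : ZMod p} (hf : B ∩ (-f +ᵥ A) = {b}) : (A ∪ (f +ᵥ B)) + {b} = A + B := by
    obtain ⟨hbB, hbA⟩ := mem_inter.1 (hf ▸ mem_singleton_self b)
    refine eq_of_subset_of_card_le
      (union_vadd_add_singleton_subset hbB (mem_neg_vadd_finset_iff.1 hbA)) ?_
    have hcard : #(A ∪ (f +ᵥ B)) + #(B ∩ (-f +ᵥ A)) = #A + #B := addDysonETransform.card f (A, B)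
    rw [hf, card_singleton] at hcard
    rw [card_add_singleton]
    omega
  have hbB : b ∈ B := mem_of_mem_inter_left (hd ▸ mem_singleton_self b)
  have hunion : A ∪ (d +ᵥ B) = A ∪ (e +ᵥ B) := by
    have := (union_eq hd).trans (union_eq he).symm
    rwa [add_singleton, add_singleton, vadd_left_cancel_iff] at this
  have hcard := card_erase_of_mem hbB
  refine eq_of_vadd_finset_eq (Z := B.erase b) (card_pos.1 (by omega)) (by omega) ?_
  rw [← union_vadd_sdiff_of_inter_neg_vadd_eq_singleton hd, hunion,
    union_vadd_sdiff_of_inter_neg_vadd_eq_singleton he]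

theorem exists_one_lt_card_inter_neg_vadd (hA : 2 ≤ #A) (hB : 3 ≤ #B)
    (hAB : #(A + B) + 1 ≤ #A + #B) (hp : #(A + B) + 2 ≤ p) :
    ∃ e : ZMod p, 2 ≤ #(B ∩ (-e +ᵥ A)) ∧ #(B ∩ (-e +ᵥ A)) < #B := by
  by_contra! hcon
  have hAne : A.Nonempty := card_pos.1 (by omega)
  have hBne : B.Nonempty := card_pos.1 (by omega)
  set X : Finset (ZMod p) := {e | e +ᵥ B ⊆ A}
  have hlt : #B < #((A + -B) \ X) := by
    have hX : #X ≤ #A + 1 - #B := card_filter_vadd_subset_le hBne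
      ((card_le_card_add_right hBne).trans_lt (by omega))
    have hsdiff := le_card_sdiff X (A + -B)
    have hAB' := card_add_card_le_of_card_add_lt hAne hBne (by omega)
    have hsub := ZMod.cauchy_davenport Fact.out hAne hBne.neg
    rw [card_neg] at hsub
    omega
  have singleton (e) (he : e ∈ (A + -B) \ X) : ∃ b, B ∩ (-e +ᵥ A) = {b} := by
    obtain ⟨he, heX⟩ := mem_sdiff.1 he
    obtain ⟨a, ha, b, hb, rfl⟩ := mem_add.1 he
    have hmem : -b ∈ B ∩ (-(a + b) +ᵥ A) :=
      mem_inter.2 ⟨mem_neg'.1 hb, mem_neg_vadd_finset_iff.2 (by simpa using ha)⟩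
    refine card_eq_one.1 (le_antisymm ?_ (card_pos.2 ⟨_, hmem⟩))
    by_contra! htwo
    refine heX (mem_filter.2 ⟨mem_univ _, ?_⟩)
    rw [vadd_finset_subset_iff]
    exact inter_eq_left.1 (eq_of_subset_of_card_le inter_subset_left (hcon _ htwo))
  choose! f hf using singleton
  have hfB (e) (he : e ∈ (A + -B) \ X) : f e ∈ B :=
    mem_of_mem_inter_left (hf e he ▸ mem_singleton_self (f e))
  obtain ⟨e, he, e', he', hne, hee'⟩ := exists_ne_map_eq_of_card_lt_of_maps_to hlt hfB
  exact hne (eq_of_inter_neg_vadd_eq_singleton (by omega) ((card_le_univ B).trans_eq (ZMod.card p))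
    hAB (hf e he) (hee' ▸ hf e' he'))

theorem exists_isProgressionWithStep_of_card_eq_two (hA : A.Nonempty) (hB : #B = 2)
    (hAB : #(A + B) + 1 ≤ #A + #B) (hp : #(A + B) < p) :
    ∃ d : ZMod p, d ≠ 0 ∧ IsProgressionWithStep d A ∧ IsProgressionWithStep d B := by
  obtain ⟨x, y, hxy, rfl⟩ := card_eq_two.1 hB
  have hprog := isProgressionWithStep_pair x y
  exact ⟨y - x, sub_ne_zero.2 hxy.symm, .of_add hA hB.ge hprog hAB hp, hprog⟩

theorem vosper (hA : 2 ≤ #A) (hB : 2 ≤ #B) (hAB : #(A + B) + 1 ≤ #A + #B)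
    (hp : #(A + B) + 2 ≤ p) :
    ∃ d : ZMod p, d ≠ 0 ∧ IsProgressionWithStep d A ∧ IsProgressionWithStep d B := by
  induction hm : #B using Nat.strong_induction_on generalizing A B with
  | _ m ih =>
  have hAne : A.Nonempty := card_pos.1 (by omega)
  have hBne : B.Nonempty := card_pos.1 (by omega)
  obtain hB2 | hB3 := hB.eq_or_lt
  · exact exists_isProgressionWithStep_of_card_eq_two hAne hB2.symm hAB (by omega)
  obtain ⟨e, he2, helt⟩ := exists_one_lt_card_inter_neg_vadd hA hB3 hAB hp
  have hcard : #(A ∪ (e +ᵥ B)) + #(B ∩ (-e +ᵥ A)) = #A + #B :=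
    addDysonETransform.card e (A, B)
  have hsub : (A ∪ (e +ᵥ B)) + (B ∩ (-e +ᵥ A)) ⊆ A + B := addDysonETransform.subset e (A, B)
  have hA' : 2 ≤ #(A ∪ (e +ᵥ B)) := hA.trans (card_le_card subset_union_left)
  have hB' : (B ∩ (-e +ᵥ A)).Nonempty := card_pos.1 (by omega)
  have hle := card_le_card hsub
  have hCD := card_add_card_le_of_card_add_lt (A := A ∪ (e +ᵥ B))
    (B := B ∩ (-e +ᵥ A)) (hAne.mono subset_union_left) hB' (by omega)
  have heq : (A ∪ (e +ᵥ B)) + (B ∩ (-e +ᵥ A)) = A + B := eq_of_subset_of_card_le hsub (by omega)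
  obtain ⟨d, hd, hdA, -⟩ := ih _ (hm ▸ helt) hA' he2 (by omega) (by omega) rfl
  have hdAB := hdA.compl_add hB' hA' (by omega) (by omega)
  rw [heq] at hdAB
  refine ⟨d, hd, hdAB.of_compl_add hAne hBne hAB hp, ?_⟩
  rw [add_comm A B] at hdAB hAB hp
  exact hdAB.of_compl_add hBne hAne (by omega) hp

end Vosper

section SumFreeZMod

section AddCommGroup

variable {G : Type*} [AddCommGroup G] {A : Finset G}

theorem IsSumFree.zero_notMem (hA : IsSumFree A) : 0 ∉ A :=
  fun h => hA 0 h 0 h (by rwa [add_zero])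

variable [DecidableEq G]

theorem IsProgressionWithStep.eq_of_add_notMem {d x y : G} (h : IsProgressionWithStep d A)
    (hx : x ∈ A) (hxd : x + d ∉ A) (hy : y ∈ A) (hyd : y + d ∉ A) : x = y := by
  have mem {w} (hw : w ∈ A) (hwd : w + d ∉ A) : d + w ∈ (d +ᵥ A) \ A :=
    mem_sdiff.2 ⟨vadd_mem_vadd_finset hw, by rwa [add_comm]⟩
  exact add_left_cancel (card_le_one.1 h _ (mem hx hxd) _ (mem hy hyd))

theorem IsSumFree.add_subset_compl [Fintype G] (hA : IsSumFree A) : A + A ⊆ Aᶜ :=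
  add_subset_iff.2 fun x hx y hy => mem_compl.2 (hA x hx y hy)

theorem IsSumFree.add_neg_subset_compl [Fintype G] (hA : IsSumFree A) : A + -A ⊆ Aᶜ :=
  add_subset_iff.2 fun x hx y hy => mem_compl.2 fun h =>
    hA _ h _ (mem_neg'.1 hy) (by rwa [add_neg_cancel_right])

end AddCommGroup

variable {p k : ℕ} [Fact p.Prime] {d y : ZMod p} {A S : Finset (ZMod p)}

theorem zmod_eq_empty_or_eq_univ_of_add_mem (hd : d ≠ 0) (h : ∀ x ∈ S, x + d ∈ S) :
    S = ∅ ∨ S = univ := by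
  refine S.eq_empty_or_nonempty.imp_right fun ⟨x, hx⟩ => eq_univ_iff_forall.2 fun z => ?_
  have hall (n : ℕ) : x + n * d ∈ S := by
    induction n with
    | zero => simpa using hx
    | succ n ih => simpa [add_mul, add_assoc] using h _ ih
  simpa [hd] using hall ((z - x) / d).val

theorem IsProgressionWithStep.subset_image_range (h : IsProgressionWithStep d S) (hd : d ≠ 0)
    (hy : y ∈ S) (hyd : y + d ∉ S) {n : ℕ} (hn : y - n * d ∉ S) :
    S ⊆ (range n).image fun i : ℕ => y - i * d := by
  set T := (range n).image fun i : ℕ => y - i * d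
  have hyT : y ∈ T :=
    mem_image.2 ⟨0, mem_range.2 (Nat.pos_of_ne_zero fun h0 => hn (by simpa [h0] using hy)), by simp⟩
  have hclosed : ∀ x ∈ S \ T, x + d ∈ S \ T := fun x hx => by
    obtain ⟨hxS, hxT⟩ := mem_sdiff.1 hx
    refine mem_sdiff.2 ⟨?_, fun hxd => ?_⟩
    · by_contra hxd
      exact hxT (h.eq_of_add_notMem hxS hxd hy hyd ▸ hyT)
    · obtain ⟨i, hi, hix⟩ := mem_image.1 hxd
      have hx' : x = y - (i + 1 : ℕ) * d := by push_cast; linear_combination -hix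
      rcases (Nat.succ_le_of_lt (mem_range.1 hi)).lt_or_eq with hlt | heq
      · exact hxT (mem_image.2 ⟨i + 1, mem_range.2 hlt, hx'.symm⟩)
      · exact hn (heq ▸ hx' ▸ hxS)
  refine sdiff_eq_empty_iff_subset.1
    ((zmod_eq_empty_or_eq_univ_of_add_mem hd hclosed).resolve_right fun h => ?_)
  exact (mem_sdiff.1 (h ▸ mem_univ y)).2 hyT

theorem injOn_sub_natCast_mul (hd : d ≠ 0) (y : ZMod p) :
    Set.InjOn (fun i : ℕ => y - i * d) (Set.Iio p) := fun i hi j hj h => by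
  have hij : (i : ZMod p) = j := mul_right_cancel₀ hd (sub_right_injective h)
  rw [← ZMod.val_natCast_of_lt hi, hij, ZMod.val_natCast_of_lt hj]

theorem IsProgressionWithStep.exists_eq_image_range (h : IsProgressionWithStep d S) (hd : d ≠ 0)
    (hne : S.Nonempty) (huniv : S ≠ univ) :
    ∃ y, S = (range #S).image fun i : ℕ => y - i * d := by
  obtain ⟨y, hyS, hy⟩ : ∃ y ∈ S, y + d ∉ S := by
    by_contra! hcon
    exact (zmod_eq_empty_or_eq_univ_of_add_mem hd hcon).elim hne.ne_empty huniv
  have hex : ∃ n < p, y - n * d ∉ S := by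
    obtain ⟨z, hz⟩ : ∃ z, z ∉ S := by simpa [eq_univ_iff_forall] using huniv
    exact ⟨((y - z) / d).val, ZMod.val_lt _, by simpa [hd] using hz⟩
  classical
  obtain ⟨hnp, hn⟩ := Nat.find_spec hex
  have hmin {i : ℕ} (hi : i < Nat.find hex) : y - i * d ∈ S := by
    by_contra hiS
    exact Nat.find_min hex hi ⟨hi.trans hnp, hiS⟩
  have hS : S = (range (Nat.find hex)).image fun i : ℕ => y - i * d :=
    (h.subset_image_range hd hyS hy hn).antisymm
      (image_subset_iff.2 fun i hi => hmin (mem_range.1 hi))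
  have hcard : #S = Nat.find hex := by
    have := congrArg card hS
    rwa [card_image_of_injOn ((injOn_sub_natCast_mul hd y).mono fun i hi =>
      (mem_range.1 hi).trans hnp), card_range] at this
  exact ⟨y, by rwa [hcard]⟩

theorem two_mul_eq_of_neg_eq {n : ℕ} (hn : 0 < n) (hnp : n < p) (hd : d ≠ 0)
    (h : -(range n).image (fun i : ℕ => y - i * d) = (range n).image fun i : ℕ => y - i * d) :
    2 * y = (n - 1 : ℕ) * d := by
  have hsum : ∑ i ∈ range n, -(y - i * d) = ∑ i ∈ range n, (y - i * d) := by
    have hinj : Set.InjOn (fun i : ℕ => y - i * d) (range n) :=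
      (injOn_sub_natCast_mul hd y).mono fun i hi => (mem_range.1 hi).trans hnp
    have := congrArg (fun T : Finset (ZMod p) => ∑ x ∈ T, x) h
    simpa only [sum_neg_index, sum_image hinj] using this
  have hgauss : (∑ i ∈ range n, (i : ZMod p)) * 2 = n * (n - 1 : ℕ) := by
    simpa only [Nat.cast_mul, Nat.cast_sum, Nat.cast_ofNat] using
      congrArg (Nat.cast (R := ZMod p)) (sum_range_id_mul_two n)
  rw [sum_neg_distrib, sum_sub_distrib, ← sum_mul, sum_const, card_range, nsmul_eq_mul] at hsum
  have hn0 : (n : ZMod p) ≠ 0 := fun h0 =>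
    (Nat.le_of_dvd hn ((ZMod.natCast_eq_zero_iff n p).1 h0)).not_gt hnp
  refine mul_left_cancel₀ hn0 ?_
  linear_combination d * hgauss - hsum

theorem IsSumFree.add_neg_eq_compl (hk : p = 3 * k + 2) (hA : IsSumFree A) (hcard : #A = k + 1) :
    A + -A = Aᶜ := by
  have hne : A.Nonempty := card_pos.1 (by omega)
  refine eq_of_subset_of_card_le hA.add_neg_subset_compl ?_
  have := ZMod.cauchy_davenport Fact.out hne hne.neg
  rw [card_neg] at this
  rw [card_compl, ZMod.card]
  omega

theorem IsSumFree.neg_eq (hk : p = 3 * k + 2) (hA : IsSumFree A) (hcard : #A = k + 1) :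
    -A = A := by
  have hcompl := hA.add_neg_eq_compl hk hcard
  have hneg : (-A)ᶜ = -(Aᶜ) := by ext x; simp
  refine compl_injective ?_
  rw [hneg, ← hcompl, neg_add, neg_neg, add_comm]

theorem mem_middleResidues_of_add {x : ZMod p} {i : ℕ} (hi : i ≤ k) (hx : x + i = (2 * k + 1 : ℕ)) :
    x ∈ middleResidues p k := by
  refine mem_image.2 ⟨2 * k + 1 - i, mem_Icc.2 ⟨by omega, by omega⟩, ?_⟩
  rw [Nat.cast_sub (by omega), ← hx, add_sub_cancel_right]

theorem IsSumFree.exists_mul_mem_middleResidues (hk : p = 3 * k + 2) (hA : IsSumFree A)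
    (hcard : #A = k + 1) : ∃ u : ZMod p, ∀ x ∈ A, u * x ∈ middleResidues p k := by
  obtain rfl | hk0 := k.eq_zero_or_pos
  · obtain ⟨a, rfl⟩ := card_eq_one.1 hcard
    have ha : a ≠ 0 := fun ha => hA.zero_notMem (by simp [ha])
    exact ⟨a⁻¹, by simp [ha, middleResidues]⟩
  have hadd := card_le_card hA.add_subset_compl
  rw [card_compl, ZMod.card] at hadd
  obtain ⟨d, hd, hdA, -⟩ := vosper (A := A) (B := A) (by omega) (by omega) (by omega) (by omega)
  obtain ⟨y, hy⟩ := hdA.exists_eq_image_range hd (card_pos.1 (by omega)) (by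
    rintro rfl
    simp at hcard
    omega)
  rw [hcard] at hy
  have hyd : 2 * y = k * d :=
    two_mul_eq_of_neg_eq k.succ_pos (by omega) hd (hy ▸ hA.neg_eq hk hcard)
  have hp0 : (3 * k + 2 : ZMod p) = 0 := by
    exact_mod_cast (ZMod.natCast_eq_zero_iff _ _).2 hk.dvd
  have h2 : (2 : ZMod p) ≠ 0 := by
    refine fun h2 => ?_
    have := Nat.le_of_dvd two_pos ((ZMod.natCast_eq_zero_iff 2 p).1 (by exact_mod_cast h2))
    omega
  refine ⟨d⁻¹, fun x hx => ?_⟩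
  rw [hy] at hx
  obtain ⟨i, hi, rfl⟩ := mem_image.1 hx
  refine mem_middleResidues_of_add (Nat.lt_succ_iff.1 (mem_range.1 hi)) ?_
  refine mul_left_cancel₀ (mul_ne_zero h2 hd) ?_
  push_cast
  linear_combination 2 * (y - i * d) * mul_inv_cancel₀ hd + hyd - d * hp0

end SumFreeZMod

section Stability

variable {G H : Type*} [AddCommGroup G] [AddCommGroup H] {A : Finset G}

theorem card_filter_map_mem_mul_card [Fintype G] [Fintype H] [DecidableEq H] (f : G →+ H)
    (hf : Function.Surjective f) (T : Finset H) :
    #{x | f x ∈ T} * Fintype.card H = #T * Fintype.card G := by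
  have key (T : Finset H) : #{x | f x ∈ T} = #T * #{x | f x = 0} := by
    rw [card_eq_sum_card_fiberwise (f := f) (t := T) (fun x hx => by simpa using hx),
      ← smul_eq_mul, ← sum_const]
    refine sum_congr rfl fun y hy => ?_
    rw [filter_filter, ← AddMonoidHom.card_fiber_eq_of_mem_range f (hf y) (hf 0)]
    congr 1
    ext x
    simp +contextual [hy]
  have huniv := key univ
  simp only [mem_univ, filter_true, card_univ] at huniv
  rw [key, huniv]
  ring

theorem card_mul_card_le_of_map_mem [Fintype G] [Fintype H] (f : G →+ H)
    (hf : Function.Surjective f) {T : Finset H} (h : ∀ x ∈ A, f x ∈ T) :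
    #A * Fintype.card H ≤ #T * Fintype.card G := by
  classical
  rw [← card_filter_map_mem_mul_card f hf]
  exact Nat.mul_le_mul_right _ (card_le_card fun x hx => mem_filter.2 ⟨mem_univ x, h x hx⟩)

theorem exists_prime_dvd_mod_three_eq_two {m : ℕ} (hm : m % 3 = 2) :
    ∃ q, q.Prime ∧ q % 3 = 2 ∧ q ∣ m := by
  induction m using induction_on_primes with
  | zero => omega
  | one => omega
  | prime_mul q a hq ih =>
    by_cases hq2 : q % 3 = 2
    · exact ⟨q, hq, hq2, dvd_mul_right q a⟩
    have ha : a % 3 = 2 := by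
      rw [Nat.mul_mod] at hm
      have := Nat.mod_lt q three_pos
      have := Nat.mod_lt a three_pos
      interval_cases q % 3 <;> omega
    obtain ⟨r, hr, hr2, hra⟩ := ih ha
    exact ⟨r, hr, hr2, hra.mul_left q⟩

theorem card_cosetHull [Finite G] (K : AddSubgroup G) (A : Finset G) [DecidableEq (G ⧸ K)] :
    #(cosetHull K A) = #(A.image (QuotientAddGroup.mk : G → G ⧸ K)) * Nat.card K := by
  have := Fintype.ofFinite G
  have := Fintype.ofFinite (G ⧸ K)
  have hhull : cosetHull K A = univ.filter fun x =>
      QuotientAddGroup.mk' K x ∈ A.image (QuotientAddGroup.mk : G → G ⧸ K) := by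
    ext x
    rw [mem_filter]
    simp [mem_cosetHull, QuotientAddGroup.eq, sub_eq_neg_add]
  have hcard := card_filter_map_mem_mul_card _ (QuotientAddGroup.mk'_surjective K)
    (A.image (QuotientAddGroup.mk : G → G ⧸ K))
  rw [← hhull, ← Nat.card_eq_fintype_card (α := G),
    AddSubgroup.card_eq_card_quotient_mul_card_addSubgroup K, Nat.card_eq_fintype_card (α := G ⧸ K),
    mul_left_comm, mul_comm] at hcard
  exact Nat.eq_of_mul_eq_mul_left Fintype.card_pos hcard

variable [Fintype G]

theorem IsSumFree.exists_quotient (hA : IsSumFree A) (hcard : Fintype.card G < 3 * #A) :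
    ∃ (K : AddSubgroup G) (T : Finset (G ⧸ K)), IsSumFree T ∧ 3 * #T = Nat.card (G ⧸ K) + 1 ∧
      ∀ x ∈ A, (x : G ⧸ K) ∈ T := by
  classical
  set K := AddAction.stabilizer G (A + A)
  have hsf {x y z : G} (hx : x ∈ A) (hy : y ∈ A) (hz : z ∈ A) : x + y - z ∉ K := fun h => by
    have hzA : z ∈ A + A := mem_of_le_stabilizer (K := K) le_rfl (add_mem_add hx hy)
      (by rw [← neg_sub]; exact K.neg_mem h)
    obtain ⟨u, hu, v, hv, rfl⟩ := mem_add.1 hzA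
    exact hA u hu v hv hz
  have hdisj : Disjoint (A + A) (cosetHull K A) := by
    refine Finset.disjoint_left.2 fun w hw hwA => ?_
    obtain ⟨x, hx, y, hy, rfl⟩ := mem_add.1 hw
    obtain ⟨z, hz, h⟩ := mem_cosetHull.1 hwA
    exact hsf hx hy hz h
  have hunion := card_le_univ (A + A ∪ cosetHull K A)
  rw [card_union_of_disjoint hdisj] at hunion
  have hkneser : #(cosetHull K A) + #(cosetHull K A) ≤ #(A + A) + Nat.card K := kneser A A
  have hsub := card_le_card (subset_cosetHull K A)
  have hn : Fintype.card G = Nat.card (G ⧸ K) * Nat.card K := by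
    rw [← Nat.card_eq_fintype_card, AddSubgroup.card_eq_card_quotient_mul_card_addSubgroup K]
  have hhull := card_cosetHull K A
  have hK : 0 < Nat.card K := Nat.card_pos
  refine ⟨K, A.image (QuotientAddGroup.mk : G → G ⧸ K), ?_, le_antisymm ?_ ?_,
    fun x hx => mem_image_of_mem _ hx⟩
  · simp only [IsSumFree, forall_mem_image]
    intro x hx y hy hxy
    obtain ⟨z, hz, h⟩ := mem_image.1 hxy
    refine hsf hx hy hz ((QuotientAddGroup.eq_iff_sub_mem).1 ?_)
    rw [h, QuotientAddGroup.mk_add]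
  · refine le_of_mul_le_mul_right ?_ hK
    linarith
  · refine Nat.succ_le_of_lt (lt_of_mul_lt_mul_right (a := Nat.card K) ?_ hK.le)
    linarith

variable {p k : ℕ}

theorem IsTypeI.le_card_quotient (hG : IsTypeI p G) {K : AddSubgroup G}
    (hK : Nat.card (G ⧸ K) % 3 = 2) : p ≤ Nat.card (G ⧸ K) := by
  obtain ⟨q, hq, hq2, hqK⟩ := exists_prime_dvd_mod_three_eq_two hK
  have hKG := AddSubgroup.card_quotient_dvd_card K
  rw [Nat.card_eq_fintype_card (α := G)] at hKG
  exact (hG.2 ⟨hq, hq2, hqK.trans hKG⟩).trans (Nat.le_of_dvd Nat.card_pos hqK)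

theorem card_mul_natCard_quotient_le {K : AddSubgroup G} {T : Finset (G ⧸ K)}
    (h : ∀ x ∈ A, (x : G ⧸ K) ∈ T) : #A * Nat.card (G ⧸ K) ≤ #T * Fintype.card G := by
  have : Fintype (G ⧸ K) := Fintype.ofFinite _
  rw [Nat.card_eq_fintype_card]
  exact card_mul_card_le_of_map_mem _ (QuotientAddGroup.mk'_surjective K) h

theorem IsSumFree.card_mul_le (hk : p = 3 * k + 2) (hG : IsTypeI p G) (hA : IsSumFree A) :
    #A * p ≤ (k + 1) * Fintype.card G := by
  obtain h | h := le_or_gt (3 * #A) (Fintype.card G)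
  · nlinarith
  obtain ⟨K, T, -, hT, hAT⟩ := hA.exists_quotient h
  have hp : p ≤ Nat.card (G ⧸ K) := hG.le_card_quotient (by omega)
  have hcard := card_mul_natCard_quotient_le hAT
  set m := Nat.card (G ⧸ K)
  refine le_of_mul_le_mul_right (a := 3 * m) ?_ (by omega)
  calc #A * p * (3 * m) = #A * m * (3 * p) := by ring
    _ ≤ #T * Fintype.card G * (3 * p) := Nat.mul_le_mul_right _ hcard
    _ = Fintype.card G * ((m + 1) * p) := by rw [← hT]; ring
    _ ≤ Fintype.card G * (m * (p + 1)) := Nat.mul_le_mul_left _ (by linarith)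
    _ = (k + 1) * Fintype.card G * (3 * m) := by rw [hk]; ring

theorem natCard_quotient_le {K : AddSubgroup G} {T : Finset (G ⧸ K)}
    (h : ∀ x ∈ A, (x : G ⧸ K) ∈ T) (hT : 3 * #T = Nat.card (G ⧸ K) + 1)
    (hcard : (p + 2) * Fintype.card G < 3 * (p + 1) * #A) : Nat.card (G ⧸ K) ≤ p := by
  have hle := card_mul_natCard_quotient_le h
  have hm : 0 < Nat.card (G ⧸ K) := Nat.card_pos
  set m := Nat.card (G ⧸ K)
  have hlt : (p + 2) * m * Fintype.card G < (m + 1) * (p + 1) * Fintype.card G :=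
    calc (p + 2) * m * Fintype.card G = (p + 2) * Fintype.card G * m := by ring
      _ < 3 * (p + 1) * #A * m := Nat.mul_lt_mul_of_pos_right hcard hm
      _ = 3 * (p + 1) * (#A * m) := by ring
      _ ≤ 3 * (p + 1) * (#T * Fintype.card G) := Nat.mul_le_mul_left _ hle
      _ = (m + 1) * (p + 1) * Fintype.card G := by rw [← hT]; ring
  linarith [lt_of_mul_lt_mul_right hlt (Nat.zero_le _)]

theorem IsSumFree.exists_hom (hp : p.Prime) (hk : p = 3 * k + 2) (hG : IsTypeI p G)
    (hA : IsSumFree A) (hcard : (p + 2) * Fintype.card G < 3 * (p + 1) * #A) :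
    ∃ ψ : G →+ ZMod p, ∀ x ∈ A, ψ x ∈ middleResidues p k := by
  have : Fact p.Prime := ⟨hp⟩
  obtain ⟨K, T, hTfree, hT, hAT⟩ := hA.exists_quotient (by
    by_contra! hcon
    nlinarith [Fintype.card_pos (α := G)])
  have hcardK : Nat.card (G ⧸ K) = p :=
    (natCard_quotient_le hAT hT hcard).antisymm (hG.le_card_quotient (by omega))
  have : IsAddCyclic (G ⧸ K) := isAddCyclic_of_prime_card hcardK
  let e : G ⧸ K ≃+ ZMod p := (hcardK ▸ zmodAddCyclicAddEquiv inferInstance).symm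
  have hfree : IsSumFree (T.map e.toEquiv.toEmbedding) := by
    simp only [IsSumFree, forall_mem_map]
    intro x hx y hy hxy
    refine hTfree x hx y hy ?_
    simpa [← map_add] using hxy
  obtain ⟨u, hu⟩ := hfree.exists_mul_mem_middleResidues hk (by rw [card_map]; omega)
  exact ⟨(AddMonoidHom.mulLeft u).comp (e.toAddMonoidHom.comp (QuotientAddGroup.mk' K)),
    fun x hx => hu _ (mem_map_of_mem _ (hAT x hx))⟩

end Stability

section Removal

universe u

section SchurPairs

variable {G : Type*}

/-- The pairs of elements of `F` whose sum is in `F`, i.e. the solutions of `x + y = z` in `F`. -/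
def schurPairs [Add G] [DecidableEq G] (F : Finset G) : Finset (G × G) :=
  {x ∈ F ×ˢ F | x.1 + x.2 ∈ F}

theorem mem_schurPairs [Add G] [DecidableEq G] {F : Finset G} {x : G × G} :
    x ∈ schurPairs F ↔ (x.1 ∈ F ∧ x.2 ∈ F) ∧ x.1 + x.2 ∈ F := by
  simp [schurPairs]

/-- The triples `(x, y, x + y)` with `(x, y) ∈ T` differ pairwise in each coordinate. -/
structure HasInjectiveCoordinates [Add G] (T : Finset (G × G)) : Prop where
  fst : Set.InjOn Prod.fst (T : Set (G × G))
  snd : Set.InjOn Prod.snd (T : Set (G × G))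
  sum : Set.InjOn (fun x => x.1 + x.2) (T : Set (G × G))

variable [Add G] [DecidableEq G] {F : Finset G} {T : Finset (G × G)}

/-- The elements occurring in a triple `(x, y, x + y)` with `(x, y) ∈ T`. -/
def schurSupport (T : Finset (G × G)) : Finset G :=
  T.image Prod.fst ∪ T.image Prod.snd ∪ T.image fun x => x.1 + x.2

theorem card_schurSupport_le (T : Finset (G × G)) : #(schurSupport T) ≤ 3 * #T :=
  calc #(schurSupport T) ≤ #T + #T + #T :=
        (card_union_le _ _).trans (Nat.add_le_add ((card_union_le _ _).trans
          (Nat.add_le_add card_image_le card_image_le)) card_image_le)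
    _ = 3 * #T := by ring

theorem HasInjectiveCoordinates.insert (hT : HasInjectiveCoordinates T) {x y : G}
    (hx : x ∉ schurSupport T) (hy : y ∉ schurSupport T) (hxy : x + y ∉ schurSupport T) :
    (x, y) ∉ T ∧ HasInjectiveCoordinates (insert (x, y) T) := by
  simp only [schurSupport, mem_union, not_or] at hx hy hxy
  have hnot : (x, y) ∉ T := fun h => hx.1.1 (mem_image_of_mem Prod.fst h)
  refine ⟨hnot, ?_, ?_, ?_⟩ <;> rw [coe_insert, Set.injOn_insert (mod_cast hnot)]
  · exact ⟨hT.fst, mod_cast hx.1.1⟩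
  · exact ⟨hT.snd, mod_cast hy.1.2⟩
  · exact ⟨hT.sum, mod_cast hxy.2⟩

theorem exists_hasInjectiveCoordinates_isSumFree_sdiff (F : Finset G) :
    ∃ T ⊆ schurPairs F, HasInjectiveCoordinates T ∧ IsSumFree (F \ schurSupport T) := by
  classical
  obtain ⟨T, hT, hmax⟩ := exists_max_image {T ∈ (schurPairs F).powerset | HasInjectiveCoordinates T}
    card ⟨∅, by simpa using ⟨by simp, by simp, by simp⟩⟩
  simp only [mem_filter, mem_powerset] at hT hmax
  refine ⟨T, hT.1, hT.2, fun x hx y hy hxy => ?_⟩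
  rw [mem_sdiff] at hx hy hxy
  obtain ⟨hnot, hins⟩ := hT.2.insert hx.2 hy.2 hxy.2
  have hsub : insert (x, y) T ⊆ schurPairs F :=
    insert_subset (mem_schurPairs.2 ⟨⟨hx.1, hy.1⟩, hxy.1⟩) hT.1
  exact (card_lt_card (ssubset_insert hnot)).not_ge (hmax _ ⟨hsub, hins⟩)

end SchurPairs

variable {G : Type*} [AddCommGroup G] [Fintype G] [DecidableEq G] {F : Finset G}
  {T : Finset (G × G)}

/-- The triangles `(a, b, c)` of the tripartite graph in which `T` prescribes the differences
`(b - a, c - b)`. -/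
def schurTriangles (T : Finset (G × G)) : Finset (G × G × G) :=
  (univ ×ˢ T).image fun x : G × G × G => (x.1, x.1 + x.2.1, x.1 + x.2.1 + x.2.2)

theorem mem_schurTriangles {a b c : G} :
    (a, b, c) ∈ schurTriangles T ↔ (b - a, c - b) ∈ T := by
  simp only [schurTriangles, mem_image, mem_product, mem_univ, true_and, Prod.exists,
    Prod.mk.injEq]
  constructor
  · rintro ⟨g, x, y, h, rfl, rfl, rfl⟩
    simpa using h
  · intro h
    exact ⟨a, b - a, c - b, h, rfl, by abel, by abel⟩

theorem card_schurTriangles (T : Finset (G × G)) :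
    #(schurTriangles T) = Fintype.card G * #T := by
  rw [schurTriangles, card_image_of_injective, card_product, card_univ]
  rintro ⟨a, b, c⟩ ⟨a', b', c'⟩ h
  simp only [Prod.mk.injEq] at h ⊢
  obtain ⟨rfl, hb, hc⟩ := h
  obtain rfl := add_left_cancel hb
  exact ⟨rfl, rfl, add_left_cancel hc⟩

open SimpleGraph TripartiteFromTriangles

theorem HasInjectiveCoordinates.explicitDisjoint (hT : HasInjectiveCoordinates T) :
    ExplicitDisjoint (schurTriangles T) where
  inj₀ a b c a' h h' := by
    simpa using hT.snd (mem_schurTriangles.1 h) (mem_schurTriangles.1 h') rfl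
  inj₁ a b c b' h h' := by
    have := hT.sum (mem_schurTriangles.1 h) (mem_schurTriangles.1 h') (by simp)
    exact sub_left_injective (congrArg Prod.fst this)
  inj₂ a b c c' h h' := by
    simpa using hT.fst (mem_schurTriangles.1 h) (mem_schurTriangles.1 h') rfl

theorem card_cliqueFinset_schurTriangles_le (hT : T ⊆ schurPairs F) :
    #((graph (schurTriangles T)).cliqueFinset 3) ≤ Fintype.card G * #(schurPairs F) := by
  rw [← card_schurTriangles, ← card_map toTriangle]
  refine card_le_card fun s hs => ?_
  rw [mem_cliqueFinset_iff, is3Clique_iff] at hs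
  obtain ⟨x, y, z, hxy, hxz, hyz, rfl⟩ := hs
  obtain ⟨a, b, c, habc, h₀₁, h₀₂, h₁₂⟩ := graph_triple hxy hxz hyz
  obtain ⟨c', h₀₁⟩ := Graph.in₀₁_iff.1 h₀₁
  obtain ⟨b', h₀₂⟩ := Graph.in₀₂_iff.1 h₀₂
  obtain ⟨a', h₁₂⟩ := Graph.in₁₂_iff.1 h₁₂
  have hab := mem_schurPairs.1 (hT (mem_schurTriangles.1 h₀₁))
  have hac := mem_schurPairs.1 (hT (mem_schurTriangles.1 h₀₂))
  have hbc := mem_schurPairs.1 (hT (mem_schurTriangles.1 h₁₂))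
  refine mem_map.2 ⟨(a, b, c), mem_schurTriangles.2 (mem_schurPairs.2 ⟨⟨hab.1.1, hbc.1.2⟩, ?_⟩),
    by simpa using habc⟩
  simpa using hac.2

theorem HasInjectiveCoordinates.le_card_schurPairs (hT : HasInjectiveCoordinates T)
    (hTF : T ⊆ schurPairs F) {ε : ℝ} (hε : ε * Fintype.card G ≤ 3 * #T) :
    27 * triangleRemovalBound (ε / 27) * (Fintype.card G : ℝ) ^ 2 ≤ #(schurPairs F) := by
  have := hT.explicitDisjoint
  have hn : (0 : ℝ) < Fintype.card G := by exact_mod_cast Fintype.card_pos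
  have hfar : (graph (schurTriangles T)).FarFromTriangleFree (ε / 27) := by
    refine farFromTriangleFree _ ?_
    rw [card_schurTriangles]
    push_cast
    nlinarith
  refine le_of_mul_le_mul_left ?_ hn
  calc (Fintype.card G : ℝ) * (27 * triangleRemovalBound (ε / 27) * (Fintype.card G : ℝ) ^ 2)
      = triangleRemovalBound (ε / 27) * (Fintype.card (G ⊕ G ⊕ G) : ℝ) ^ 3 := by
        simp only [Fintype.card_sum]
        push_cast
        ring
    _ ≤ (#((graph (schurTriangles T)).cliqueFinset 3) : ℝ) := by
        convert hfar.le_card_cliqueFinset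
    _ ≤ (Fintype.card G : ℝ) * #(schurPairs F) := by
        exact_mod_cast card_cliqueFinset_schurTriangles_le hTF

theorem exists_isSumFree_of_card_schurPairs_lt {ε : ℝ} (hε : 0 < ε) :
    ∃ δ > 0, ∀ (G : Type u) [AddCommGroup G] [Fintype G] [DecidableEq G] (F : Finset G),
      (#(schurPairs F) : ℝ) < δ * (Fintype.card G : ℝ) ^ 2 →
      ∃ B ⊆ F, IsSumFree B ∧ (#(F \ B) : ℝ) ≤ ε * Fintype.card G := by
  refine ⟨27 * triangleRemovalBound (ε / 27),
    mul_pos (by norm_num) (triangleRemovalBound_pos (by positivity)), ?_⟩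
  intro G _ _ _ F hF
  obtain ⟨T, hTF, hT, hfree⟩ := exists_hasInjectiveCoordinates_isSumFree_sdiff F
  have hsmall : 3 * (#T : ℝ) < ε * Fintype.card G := by
    by_contra! hcon
    exact (hT.le_card_schurPairs hTF hcon).not_gt hF
  have hcard : #(F \ (F \ schurSupport T)) ≤ 3 * #T := by
    rw [sdiff_sdiff_right_self]
    exact (card_le_card inter_subset_right).trans (card_schurSupport_le T)
  refine ⟨F \ schurSupport T, sdiff_subset, hfree, hsmall.le.trans' ?_⟩
  exact_mod_cast hcard

end Removal

section Containers

universe u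

theorem card_subsets_card_le_mul_rpow_le (V : Type*) [Fintype V] {x : ℝ} (hx : 0 < x) (hx1 : x ≤ 1)
    (m : ℝ) : (#{U : Finset V | (#U : ℝ) ≤ m} : ℝ) * x ^ m ≤ (x + 1) ^ Fintype.card V := by
  have hbinom := sum_pow_mul_eq_add_pow x 1 (univ : Finset V)
  simp only [card_univ, one_pow, mul_one, powerset_univ] at hbinom
  rw [← hbinom, ← nsmul_eq_mul, ← sum_const]
  refine (sum_le_sum (g := fun U => x ^ #U) fun U hU => ?_).trans
    (sum_le_sum_of_subset_of_nonneg (subset_univ _) fun U _ _ => by positivity)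
  rw [← Real.rpow_natCast]
  exact Real.rpow_le_rpow_of_exponent_ge hx hx1 (mem_filter.1 hU).2

theorem exists_card_subsets_card_le {γ : ℝ} (hγ : 0 < γ) :
    ∃ τ > 0, ∀ (V : Type u) [Fintype V],
      (#{U : Finset V | (#U : ℝ) ≤ τ * Fintype.card V} : ℝ) ≤ 2 ^ (γ * Fintype.card V) := by
  obtain ⟨x, hx, hx1, hx2⟩ : ∃ x : ℝ, 0 < x ∧ x ≤ 1 ∧ x + 1 ≤ 2 ^ (γ / 2) := by
    have : (1 : ℝ) < 2 ^ (γ / 2) := Real.one_lt_rpow (by norm_num) (by positivity)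
    exact ⟨min 1 (2 ^ (γ / 2) - 1), lt_min one_pos (by linarith), min_le_left _ _,
      le_sub_iff_add_le.1 (min_le_right _ _)⟩
  have hlog := Real.log_nonpos hx.le hx1
  have hlog2 : 0 < Real.log 2 := Real.log_pos (by norm_num)
  -- With this `τ`, `x ^ (-τ) ≤ 2 ^ (γ / 2)`.
  set τ : ℝ := γ / 2 * Real.log 2 / (1 - Real.log x)
  have hτ0 : 0 < τ := div_pos (mul_pos (half_pos hγ) hlog2) (by linarith)
  refine ⟨τ, hτ0, fun V _ => ?_⟩
  set n : ℝ := (Fintype.card V : ℝ) with hn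
  have hpow : (1 : ℝ) ≤ 2 ^ (γ / 2 * n) * x ^ (τ * n) := by
    have hmul : τ * (1 - Real.log x) = γ / 2 * Real.log 2 :=
      div_mul_cancel₀ _ (by linarith)
    rw [Real.rpow_def_of_pos (by norm_num : (0 : ℝ) < 2), Real.rpow_def_of_pos hx, ← Real.exp_add]
    refine Real.one_le_exp ?_
    calc 0 ≤ τ * n := mul_nonneg hτ0.le (Nat.cast_nonneg _)
      _ = Real.log 2 * (γ / 2 * n) + Real.log x * (τ * n) := by linear_combination n * hmul
  set N := #{U : Finset V | (#U : ℝ) ≤ τ * n}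
  calc (N : ℝ) ≤ N * (2 ^ (γ / 2 * n) * x ^ (τ * n)) :=
        le_mul_of_one_le_right (Nat.cast_nonneg _) hpow
    _ = 2 ^ (γ / 2 * n) * (N * x ^ (τ * n)) := by ring
    _ ≤ 2 ^ (γ / 2 * n) * (2 ^ (γ / 2)) ^ Fintype.card V := by
        gcongr
        exact (card_subsets_card_le_mul_rpow_le V hx hx1 _).trans
          (pow_le_pow_left₀ (by positivity) hx2 _)
    _ = 2 ^ (γ * n) := by
        rw [← Real.rpow_natCast, ← Real.rpow_mul (by norm_num), ← Real.rpow_add (by norm_num), ← hn]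
        ring_nf

section Graph

variable {V : Type*} [DecidableEq V] {r : V → V → Prop} [DecidableRel r] {d : ℕ} {F : Finset V}

/-- `φ` is the reconstruction map of the graph container algorithm: from a fingerprint `S` it
produces a subset of `F` of maximum degree less than `d`, in such a way that every independent
`A ⊆ F` contains a fingerprint `S` of size at most `#F / d` with `A ⊆ φ S ∪ S`. -/
structure IsContainerMap (r : V → V → Prop) [DecidableRel r] (d : ℕ) (F : Finset V)
    (φ : Finset V → Finset V) : Prop where
  subset (S : Finset V) : φ S ⊆ F
  degree_lt (S : Finset V) : ∀ v ∈ φ S, #{w ∈ φ S | r v w} < d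
  exists_fingerprint : ∀ A ⊆ F, (∀ x ∈ A, ∀ y ∈ A, ¬ r x y) →
    ∃ S ⊆ A, #S * d ≤ #F ∧ A ⊆ φ S ∪ S

theorem IsContainerMap.ite {v : V} {φ₀ φ₁ : Finset V → Finset V}
    (h₀ : IsContainerMap r d (F.erase v) φ₀)
    (h₁ : IsContainerMap r d (F.erase v \ {w ∈ F | r v w}) φ₁) (hd : d ≤ #{w ∈ F | r v w}) :
    IsContainerMap r d F fun S => if v ∈ S then φ₁ (S.erase v) else φ₀ S where
  subset S := by
    split_ifs
    · exact (h₁.subset _).trans (sdiff_subset.trans (erase_subset v F))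
    · exact (h₀.subset _).trans (erase_subset v F)
  degree_lt S := by
    split_ifs
    · exact h₁.degree_lt _
    · exact h₀.degree_lt _
  exists_fingerprint A hA hind := by
    by_cases hvA : v ∈ A
    · have hsub : A.erase v ⊆ F.erase v \ {w ∈ F | r v w} := fun x hx =>
        mem_sdiff.2 ⟨erase_subset_erase v hA hx, fun h =>
          hind v hvA x (mem_of_mem_erase hx) (mem_filter.1 h).2⟩
      obtain ⟨S, hS, hcard, hAS⟩ := h₁.exists_fingerprint _ hsub fun x hx y hy =>
        hind x (mem_of_mem_erase hx) y (mem_of_mem_erase hy)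
      have hvS : v ∉ S := fun h => notMem_erase v A (hS h)
      refine ⟨insert v S, insert_subset hvA (hS.trans (erase_subset _ _)), ?_, ?_⟩
      · have hle : #(F.erase v \ {w ∈ F | r v w}) ≤ #(F \ {w ∈ F | r v w}) :=
          card_le_card (sdiff_subset_sdiff (erase_subset v F) le_rfl)
        have : #(F \ {w ∈ F | r v w}) + #{w ∈ F | r v w} = #F :=
          card_sdiff_add_card_eq_card (filter_subset _ _)
        rw [card_insert_of_notMem hvS, add_one_mul]
        omega
      · rw [if_pos (mem_insert_self v S), erase_insert hvS, union_insert, ← insert_erase hvA]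
        exact insert_subset_insert v hAS
    · obtain ⟨S, hS, hcard, hAS⟩ := h₀.exists_fingerprint A (subset_erase.2 ⟨hA, hvA⟩) hind
      refine ⟨S, hS, hcard.trans (card_le_card (erase_subset v F)), ?_⟩
      rwa [if_neg fun h => hvA (hS h)]

theorem exists_isContainerMap (r : V → V → Prop) [DecidableRel r] (d : ℕ) (F : Finset V) :
    ∃ φ, IsContainerMap r d F φ := by
  induction F using Finset.strongInduction with
  | _ F ih =>
  by_cases! hF : ∃ v ∈ F, d ≤ #{w ∈ F | r v w}
  · obtain ⟨v, hv, hd⟩ := hF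
    have hss := erase_ssubset hv
    obtain ⟨φ₀, h₀⟩ := ih _ hss
    obtain ⟨φ₁, h₁⟩ := ih _ (sdiff_subset.trans_ssubset hss)
    exact ⟨_, h₀.ite h₁ hd⟩
  · exact ⟨fun _ => F, fun _ => Subset.rfl, fun _ => hF,
      fun A hA _ => ⟨∅, empty_subset _, by simp, by simpa using hA⟩⟩

end Graph

section SchurDegree

variable {G : Type*} [AddCommGroup G] [DecidableEq G] {C F T : Finset G}

/-- The number of `y ∈ F` with `y + t ∈ F`. -/
def schurDegree (F : Finset G) (t : G) : ℕ :=
  #{y ∈ F | y + t ∈ F}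

theorem card_schurPairs_eq (F : Finset G) : #(schurPairs F) = ∑ t ∈ F, schurDegree F t := by
  rw [schurPairs, card_filter, sum_product]
  refine sum_congr rfl fun t _ => ?_
  rw [schurDegree, card_filter]
  simp only [add_comm]

theorem schurDegree_le (F C : Finset G) (t : G) :
    schurDegree F t ≤ schurDegree C t + 2 * #(F \ C) := by
  have hsub : {y ∈ F | y + t ∈ F} ⊆
      {y ∈ C | y + t ∈ C} ∪ ((F \ C) ∪ (F \ C).image (· - t)) := by
    intro y hy
    obtain ⟨hy, hyt⟩ := mem_filter.1 hy
    simp only [mem_union, mem_filter, mem_sdiff, mem_image]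
    by_cases hyC : y ∈ C
    · by_cases hytC : y + t ∈ C
      · exact Or.inl ⟨hyC, hytC⟩
      · exact Or.inr (Or.inr ⟨y + t, ⟨hyt, hytC⟩, by abel⟩)
    · exact Or.inr (Or.inl ⟨hy, hyC⟩)
  refine (card_le_card hsub).trans ((card_union_le _ _).trans (Nat.add_le_add_left ?_ _))
  refine (card_union_le _ _).trans ?_
  rw [two_mul]
  exact Nat.add_le_add_left card_image_le _

variable [Fintype G]

theorem sum_schurDegree_le {d : ℕ} (hC : ∀ v ∈ C, #{z ∈ C | z - v ∈ T} ≤ d) :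
    ∑ t ∈ T, schurDegree C t ≤ Fintype.card G * d := by
  have hswap : ∑ t ∈ T, schurDegree C t = ∑ y ∈ C, #{t ∈ T | y + t ∈ C} := by
    simp only [schurDegree, card_filter]
    exact sum_comm
  have hle : ∀ y ∈ C, #{t ∈ T | y + t ∈ C} ≤ d := fun y hy => by
    refine (card_le_card_of_injOn (y + ·) (fun t ht => ?_) (add_right_injective y).injOn).trans
      (hC y hy)
    simpa [and_comm] using ht
  rw [hswap]
  exact (sum_le_card_nsmul C _ d hle).trans (Nat.mul_le_mul_right _ (card_le_univ C))

variable {δ : ℝ}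

theorem le_card_filter_le_schurDegree
    (hF : δ * (Fintype.card G : ℝ) ^ 2 < #(schurPairs F)) :
    δ / 2 * Fintype.card G ≤ (#{t ∈ F | δ / 2 * Fintype.card G ≤ schurDegree F t} : ℝ) := by
  set n : ℝ := (Fintype.card G : ℝ) with hn
  have hn0 : 0 < n := by rw [hn]; exact_mod_cast Fintype.card_pos
  obtain hδ | hδ := le_total δ 0
  · exact (mul_nonpos_of_nonpos_of_nonneg (by linarith) hn0.le).trans (Nat.cast_nonneg _)
  have hcard (s : Finset G) : (#s : ℝ) ≤ n := by rw [hn]; exact_mod_cast card_le_univ s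
  have hheavy : ∑ t ∈ F with δ / 2 * n ≤ schurDegree F t, (schurDegree F t : ℝ) ≤
      #{t ∈ F | δ / 2 * n ≤ schurDegree F t} * n := by
    rw [← nsmul_eq_mul]
    exact sum_le_card_nsmul _ _ _ fun t _ => hcard _
  have hlight : ∑ t ∈ F with ¬ δ / 2 * n ≤ schurDegree F t, (schurDegree F t : ℝ) ≤
      n * (δ / 2 * n) := by
    refine (sum_le_card_nsmul _ _ (δ / 2 * n) fun t ht => ?_).trans ?_
    · exact (not_le.1 (mem_filter.1 ht).2).le
    · rw [nsmul_eq_mul]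
      exact mul_le_mul_of_nonneg_right (hcard _) (by positivity)
  rw [card_schurPairs_eq, Nat.cast_sum, ← sum_filter_add_sum_filter_not F
    (fun t => δ / 2 * n ≤ schurDegree F t)] at hF
  refine le_of_mul_le_mul_right ?_ hn0
  linarith

theorem card_mul_le_of_le_schurDegree {d : ℕ} {m : ℝ} (hT : ∀ t ∈ T, m ≤ schurDegree F t)
    (hC : ∀ v ∈ C, #{z ∈ C | z - v ∈ T} ≤ d) :
    #T * m ≤ Fintype.card G * d + #T * (2 * #(F \ C)) := by
  have hsum : ∑ t ∈ T, schurDegree F t ≤ Fintype.card G * d + #T * (2 * #(F \ C)) :=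
    calc ∑ t ∈ T, schurDegree F t ≤ ∑ t ∈ T, (schurDegree C t + 2 * #(F \ C)) :=
          sum_le_sum fun t _ => schurDegree_le F C t
      _ = ∑ t ∈ T, schurDegree C t + #T * (2 * #(F \ C)) := by
          rw [sum_add_distrib, sum_const, smul_eq_mul]
      _ ≤ _ := Nat.add_le_add_right (sum_schurDegree_le hC) _
  calc #T * m ≤ ∑ t ∈ T, (schurDegree F t : ℝ) := by
        rw [← nsmul_eq_mul]
        exact card_nsmul_le_sum _ _ _ hT
    _ ≤ _ := by exact_mod_cast hsum

/-- The container of a sum-free set `A ⊆ F` is read off from two small subsets `T` and `S` of `A`: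
if `A` contains few elements of large degree, then `T` consists of these; otherwise `T` consists
of `q` of them, and `S` is a fingerprint of `A` in the Cayley graph generated by `T`. -/
theorem exists_fingerprint_of_lt_card_schurPairs (hδ : 0 < δ) {d q : ℕ} (hd : 16 ≤ δ * d)
    (hq : 4 * d ≤ δ * q) (hqG : 4 * q ≤ δ * Fintype.card G)
    (hF : δ * (Fintype.card G : ℝ) ^ 2 < #(schurPairs F)) :
    ∃ Φ : Finset G → Finset G → Finset G, ∀ A ⊆ F, IsSumFree A →
      ∃ T S, #T ≤ q ∧ #S * d ≤ Fintype.card G ∧ A ⊆ Φ T S ∧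
        (#(Φ T S) : ℝ) ≤ #F - δ / 16 * Fintype.card G := by
  choose φ hφ using fun T : Finset G => exists_isContainerMap (fun y z : G => z - y ∈ T) d F
  have hheavy := le_card_filter_le_schurDegree hF
  set n : ℝ := (Fintype.card G : ℝ) with hn
  set heavy : Finset G := {t ∈ F | δ / 2 * n ≤ schurDegree F t}
  have hd0 : (0 : ℝ) < d := pos_of_mul_pos_right (by linarith) hδ.le
  have hq0 : (0 : ℝ) < q := pos_of_mul_pos_right (by linarith) hδ.le
  refine ⟨fun T S => if #T < q then (F \ heavy) ∪ T else φ T S ∪ S, fun A hAF hA => ?_⟩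
  obtain hfew | hmany := lt_or_ge #(A ∩ heavy) q
  · refine ⟨A ∩ heavy, ∅, hfew.le, by simp, ?_⟩
    simp only [if_pos hfew]
    refine ⟨fun x hx => ?_, ?_⟩
    · by_cases hxh : x ∈ heavy <;> simp [hx, hxh, hAF hx]
    · have hunion : (#((F \ heavy) ∪ (A ∩ heavy)) : ℝ) ≤ #(F \ heavy) + #(A ∩ heavy) := by
        exact_mod_cast card_union_le _ _
      have hF : (#(F \ heavy) : ℝ) + #heavy = #F := by
        exact_mod_cast card_sdiff_add_card_eq_card (filter_subset _ F)
      have hfew' : (#(A ∩ heavy) : ℝ) ≤ q := by exact_mod_cast hfew.le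
      linarith
  · obtain ⟨T, hT, hTq⟩ := exists_subset_card_eq hmany
    obtain ⟨S, -, hS, hAS⟩ := (hφ T).exists_fingerprint A hAF fun x hx y hy hxy =>
      hA _ (mem_inter.1 (hT hxy)).1 x hx (by simpa using hy)
    have hSn : #S * d ≤ Fintype.card G := hS.trans (card_le_univ F)
    refine ⟨T, S, hTq.le, hSn, ?_⟩
    simp only [hTq, lt_irrefl, if_false]
    refine ⟨hAS, ?_⟩
    have hSδ : (#S : ℝ) ≤ δ / 16 * n := by
      have : (#S : ℝ) * d ≤ n := by rw [hn]; exact_mod_cast hSn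
      refine le_of_mul_le_mul_right ?_ hd0
      nlinarith
    have hdense := card_mul_le_of_le_schurDegree (m := δ / 2 * n)
      (fun t ht => (mem_filter.1 (mem_inter.1 (hT ht)).2).2)
      (fun v hv => ((hφ T).degree_lt S v hv).le)
    rw [hTq, ← hn] at hdense
    have hsdiff : δ / 8 * n ≤ #(F \ φ T S) := by
      refine le_of_mul_le_mul_left ?_ hq0
      nlinarith
    have hF : (#(F \ φ T S) : ℝ) + #(φ T S) = #F := by
      exact_mod_cast card_sdiff_add_card_eq_card ((hφ T).subset S)
    have hunion : (#(φ T S ∪ S) : ℝ) ≤ #(φ T S) + #S := by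
      exact_mod_cast card_union_le _ _
    linarith

end SchurDegree

section Family

variable {G : Type*} [Add G] {𝓕 : Finset (Finset G)} {F : Finset G}

/-- Every sum-free subset of `F` is contained in a member of `𝓕`. -/
def IsContainerFamily (𝓕 : Finset (Finset G)) (F : Finset G) : Prop :=
  ∀ A ⊆ F, IsSumFree A → ∃ C ∈ 𝓕, A ⊆ C

theorem isContainerFamily_singleton (F : Finset G) : IsContainerFamily {F} F :=
  fun _ hA _ => ⟨F, mem_singleton_self F, hA⟩

theorem IsContainerFamily.biUnion [DecidableEq G] {g : Finset G → Finset (Finset G)}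
    (h : IsContainerFamily 𝓕 F) (hg : ∀ C ∈ 𝓕, IsContainerFamily (g C) C) :
    IsContainerFamily (𝓕.biUnion g) F := fun A hA hfree => by
  obtain ⟨C, hC, hAC⟩ := h A hA hfree
  obtain ⟨D, hD, hAD⟩ := hg C hC A hAC hfree
  exact ⟨D, mem_biUnion.2 ⟨C, hC, hD⟩, hAD⟩

theorem exists_isContainerFamily_pow {P : Finset G → Prop} {B c : ℝ} (hB : 1 ≤ B)
    (step : ∀ C, ¬ P C → ∃ 𝓕 : Finset (Finset G), (#𝓕 : ℝ) ≤ B ∧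
      (∀ D ∈ 𝓕, (#D : ℝ) ≤ #C - c) ∧ IsContainerFamily 𝓕 C) (F : Finset G) (j : ℕ) :
    ∃ 𝓕 : Finset (Finset G), (#𝓕 : ℝ) ≤ B ^ j ∧ (∀ C ∈ 𝓕, P C ∨ (#C : ℝ) ≤ #F - j * c) ∧
      IsContainerFamily 𝓕 F := by
  classical
  induction j with
  | zero => exact ⟨{F}, by simp, by simp, isContainerFamily_singleton F⟩
  | succ j ih =>
    obtain ⟨𝓕, hcard, hsmall, hcover⟩ := ih
    have hrefine (C) (hC : C ∈ 𝓕) : ∃ 𝓖 : Finset (Finset G), (#𝓖 : ℝ) ≤ B ∧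
        (∀ D ∈ 𝓖, P D ∨ (#D : ℝ) ≤ #F - (j + 1 : ℕ) * c) ∧ IsContainerFamily 𝓖 C := by
      by_cases hPC : P C
      · exact ⟨{C}, by simpa using hB, by simp [hPC], isContainerFamily_singleton C⟩
      obtain ⟨𝓖, h𝓖, hD, hcover⟩ := step C hPC
      refine ⟨𝓖, h𝓖, fun D hD𝓖 => Or.inr ?_, hcover⟩
      have := (hsmall C hC).resolve_left hPC
      push_cast
      linarith [hD D hD𝓖]
    choose! g hg hgsmall hgcover using hrefine
    refine ⟨𝓕.biUnion g, ?_, fun D hD => ?_, hcover.biUnion hgcover⟩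
    · calc (#(𝓕.biUnion g) : ℝ) ≤ ∑ C ∈ 𝓕, (#(g C) : ℝ) := by exact_mod_cast card_biUnion_le
        _ ≤ #𝓕 * B := by
            rw [← nsmul_eq_mul]
            exact sum_le_card_nsmul _ _ _ hg
        _ ≤ B ^ (j + 1) := by
            rw [pow_succ]
            exact mul_le_mul_of_nonneg_right hcard (zero_le_one.trans hB)
    · obtain ⟨C, hC, hD⟩ := mem_biUnion.1 hD
      exact hgsmall C hC D hD

end Family

theorem exists_isContainerFamily_of_lt_card_schurPairs {δ γ : ℝ} (hδ : 0 < δ) (hγ : 0 < γ) :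
    ∃ N : ℕ, ∀ (G : Type u) [AddCommGroup G] [Fintype G] [DecidableEq G], N ≤ Fintype.card G →
      ∀ F : Finset G, δ * (Fintype.card G : ℝ) ^ 2 < #(schurPairs F) →
      ∃ 𝓕 : Finset (Finset G), (#𝓕 : ℝ) ≤ 2 ^ (γ * Fintype.card G) ∧
        (∀ C ∈ 𝓕, (#C : ℝ) ≤ #F - δ / 16 * Fintype.card G) ∧ IsContainerFamily 𝓕 F := by
  obtain ⟨τ, hτ, hsmall⟩ := exists_card_subsets_card_le.{u} (half_pos hγ)
  obtain ⟨d, hd⟩ := exists_nat_ge (max (1 / τ) (16 / δ))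
  rw [max_le_iff, div_le_iff₀' hτ, div_le_iff₀' hδ] at hd
  obtain ⟨q, hq⟩ := exists_nat_ge (4 * d / δ)
  rw [div_le_iff₀' hδ] at hq
  obtain ⟨N, hN⟩ := exists_nat_ge (max (q / τ) (4 * q / δ))
  rw [max_le_iff, div_le_iff₀' hτ, div_le_iff₀' hδ] at hN
  refine ⟨N, fun G _ _ _ hG F hF => ?_⟩
  specialize hsmall G
  have hGN : (N : ℝ) ≤ Fintype.card G := by exact_mod_cast hG
  obtain ⟨Φ, hΦ⟩ := exists_fingerprint_of_lt_card_schurPairs hδ hd.2 hq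
    (hN.2.trans (by gcongr)) hF
  set n : ℝ := (Fintype.card G : ℝ) with hn
  set 𝒰 : Finset (Finset G) := {U | (#U : ℝ) ≤ τ * n}
  set 𝓖 := (𝒰 ×ˢ 𝒰).image fun x => Φ x.1 x.2
  refine ⟨{C ∈ 𝓖 | (#C : ℝ) ≤ #F - δ / 16 * n}, ?_, fun C hC => (mem_filter.1 hC).2,
    fun A hAF hA => ?_⟩
  · calc (#{C ∈ 𝓖 | (#C : ℝ) ≤ #F - δ / 16 * n} : ℝ) ≤ (#𝒰 : ℝ) * #𝒰 := by
          exact_mod_cast (card_filter_le _ _).trans (card_image_le.trans_eq (card_product _ _))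
      _ ≤ 2 ^ (γ / 2 * n) * 2 ^ (γ / 2 * n) := by gcongr
      _ = 2 ^ (γ * n) := by
          rw [← Real.rpow_add (by norm_num)]
          ring_nf
  · obtain ⟨T, S, hT, hS, hAΦ, hcard⟩ := hΦ A hAF hA
    have hT𝒰 : T ∈ 𝒰 := mem_filter.2 ⟨mem_univ T,
      (Nat.cast_le.2 hT).trans (hN.1.trans (by gcongr))⟩
    have hS𝒰 : S ∈ 𝒰 := by
      have hSn : (#S : ℝ) * d ≤ n := by rw [hn]; exact_mod_cast hS
      have hmul : (#S : ℝ) * 1 ≤ #S * (τ * d) := by gcongr; exact hd.1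
      refine mem_filter.2 ⟨mem_univ S, ?_⟩
      nlinarith
    exact ⟨Φ T S, mem_filter.2 ⟨mem_image.2 ⟨(T, S), mem_product.2 ⟨hT𝒰, hS𝒰⟩, rfl⟩, hcard⟩, hAΦ⟩

theorem exists_isContainerFamily {δ γ : ℝ} (hδ : 0 < δ) (hγ : 0 < γ) :
    ∃ N : ℕ, ∀ (G : Type u) [AddCommGroup G] [Fintype G] [DecidableEq G], N ≤ Fintype.card G →
      ∃ 𝓕 : Finset (Finset G), (#𝓕 : ℝ) ≤ 2 ^ (γ * Fintype.card G) ∧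
        (∀ C ∈ 𝓕, (#(schurPairs C) : ℝ) ≤ δ * (Fintype.card G : ℝ) ^ 2) ∧
        IsContainerFamily 𝓕 univ := by
  obtain ⟨J, hJ⟩ := exists_nat_gt (16 / δ)
  have hJ0 : (0 : ℝ) < J := lt_trans (by positivity) hJ
  rw [div_lt_iff₀ hδ] at hJ
  obtain ⟨N, hN⟩ := exists_isContainerFamily_of_lt_card_schurPairs.{u} hδ (div_pos hγ hJ0)
  refine ⟨N, fun G _ _ _ hG => ?_⟩
  set n : ℝ := (Fintype.card G : ℝ) with hn
  have hn0 : 0 < n := by rw [hn]; exact_mod_cast Fintype.card_pos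
  obtain ⟨𝓕, hcard, hsmall, hcover⟩ := exists_isContainerFamily_pow
    (P := fun C => (#(schurPairs C) : ℝ) ≤ δ * n ^ 2)
    (Real.one_le_rpow one_le_two (by positivity : 0 ≤ γ / J * n))
    (fun C hC => hN G hG C (not_le.1 hC)) univ J
  refine ⟨𝓕, hcard.trans_eq ?_, fun C hC => (hsmall C hC).resolve_right fun hneg => ?_, hcover⟩
  · rw [← Real.rpow_natCast, ← Real.rpow_mul (by norm_num)]
    congr 1
    field_simp
  · rw [card_univ, ← hn] at hneg
    have : (0 : ℝ) ≤ #C := Nat.cast_nonneg _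
    nlinarith

end Containers

section MiddleResidues

theorem IsProgressionWithStep.image {G H : Type*} [AddCommGroup G] [AddCommGroup H] [DecidableEq G]
    [DecidableEq H] {d : G} {S : Finset G} (h : IsProgressionWithStep d S) {f : G →+ H}
    (hf : Function.Injective f) : IsProgressionWithStep (f d) (S.image f) := by
  have hvadd : f d +ᵥ S.image f = (d +ᵥ S).image f := by
    simp only [vadd_finset_def, image_image, Function.comp_def, vadd_eq_add, map_add]
  rw [IsProgressionWithStep, hvadd, ← image_sdiff _ _ hf, card_image_of_injective _ hf]
  exact h

theorem card_middleResidues {p k : ℕ} (hk : p = 3 * k + 2) : #(middleResidues p k) = k + 1 := by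
  rw [middleResidues, card_image_of_injOn, Nat.card_Icc]
  · omega
  · intro i hi j hj hij
    simp only [coe_Icc, Set.mem_Icc] at hi hj
    have := congrArg ZMod.val hij
    simp only at this
    rwa [ZMod.val_natCast_of_lt (by omega), ZMod.val_natCast_of_lt (by omega)] at this

theorem mem_middleResidues {p k : ℕ} (hk : p = 3 * k + 2) {x : ZMod p} :
    x ∈ middleResidues p k ↔ k + 1 ≤ x.val ∧ x.val ≤ 2 * k + 1 := by
  have : NeZero p := ⟨by omega⟩
  simp only [middleResidues, mem_image, mem_Icc]
  constructor
  · rintro ⟨j, hj, rfl⟩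
    rwa [ZMod.val_natCast_of_lt (by omega)]
  · intro h
    exact ⟨x.val, h, ZMod.natCast_zmod_val x⟩

theorem isProgressionWithStep_one_middleResidues (p k : ℕ) :
    IsProgressionWithStep 1 (middleResidues p k) := by
  refine (card_le_card (t := {((2 * k + 2 : ℕ) : ZMod p)}) fun y hy => ?_).trans_eq
    (card_singleton _)
  simp only [middleResidues, mem_sdiff, mem_vadd_finset, mem_image, mem_Icc, vadd_eq_add] at hy
  obtain ⟨⟨_, ⟨j, hj, rfl⟩, rfl⟩, hnot⟩ := hy
  obtain rfl : j = 2 * k + 1 := by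
    by_contra hne
    exact hnot ⟨j + 1, by omega, by push_cast; ring⟩
  rw [mem_singleton]
  push_cast
  ring

variable {p k : ℕ} [Fact p.Prime] {t x : ZMod p}

theorem val_add_eq_or (x y : ZMod p) :
    (x + y).val = x.val + y.val ∨ (x + y).val + p = x.val + y.val :=
  (lt_or_ge (x.val + y.val) p).imp ZMod.val_add_of_lt fun h => (ZMod.val_add_val_of_le h).symm

theorem isSumFree_middleResidues (hk : p = 3 * k + 2) : IsSumFree (middleResidues p k) := by
  intro x hx y hy hxy
  rw [mem_middleResidues hk] at hx hy hxy
  have := val_add_eq_or x y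
  omega

theorem neg_middleResidues (hk : p = 3 * k + 2) : -middleResidues p k = middleResidues p k :=
  (isSumFree_middleResidues hk).neg_eq hk (card_middleResidues hk)

theorem exists_add_mem_middleResidues (hk : p = 3 * k + 2) (hx : x ∉ middleResidues p k) :
    ∃ m ∈ middleResidues p k, m + x ∈ middleResidues p k := by
  rw [← mem_compl, ← (isSumFree_middleResidues hk).add_neg_eq_compl hk (card_middleResidues hk),
    mem_add] at hx
  obtain ⟨y, hy, z, hz, rfl⟩ := hx
  exact ⟨-z, mem_neg'.1 hz, by simpa⟩

theorem eq_one_of_isProgressionWithStep_middleResidues (hk : p = 3 * k + 2) (ht : t ≠ 0)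
    (h : IsProgressionWithStep t (middleResidues p k)) (hle : t.val ≤ 2 * k + 1) : t = 1 := by
  have ht0 : t.val ≠ 0 := (ZMod.val_ne_zero t).2 ht
  by_contra ht1
  have ht1' : t.val ≠ 1 := fun h => ht1 (by rw [← ZMod.natCast_zmod_val t, h, Nat.cast_one])
  have hlast (j : ℕ) (hj : j = 2 * k ∨ j = 2 * k + 1) :
      (j : ZMod p) ∈ middleResidues p k ∧ (j : ZMod p) + t ∉ middleResidues p k := by
    have hval : (j : ZMod p).val = j := ZMod.val_natCast_of_lt (by omega)
    have := val_add_eq_or (j : ZMod p) t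
    rw [mem_middleResidues hk, mem_middleResidues hk]
    omega
  have heq := h.eq_of_add_notMem (hlast (2 * k) (by simp)).1 (hlast _ (by simp)).2
    (hlast (2 * k + 1) (by simp)).1 (hlast _ (by simp)).2
  simp at heq

theorem eq_one_or_eq_neg_one_of_mul_mem_middleResidues (hk : p = 3 * k + 2) (ht : t ≠ 0)
    (h : ∀ m ∈ middleResidues p k, t * m ∈ middleResidues p k) : t = 1 ∨ t = -1 := by
  have hstep {s : ZMod p} (hs : s ≠ 0) (h : ∀ m ∈ middleResidues p k, s * m ∈ middleResidues p k) :
      IsProgressionWithStep s (middleResidues p k) := by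
    have hinj : Function.Injective (AddMonoidHom.mulLeft s) := mul_right_injective₀ hs
    have himage : (middleResidues p k).image (AddMonoidHom.mulLeft s) = middleResidues p k :=
      eq_of_subset_of_card_le (image_subset_iff.2 h) (card_image_of_injective _ hinj).ge
    have hprog := (isProgressionWithStep_one_middleResidues p k).image hinj
    rwa [himage, AddMonoidHom.coe_mulLeft, mul_one] at hprog
  have hneg : t.val + (-t).val = p := by
    have : NeZero t := ⟨ht⟩
    rw [ZMod.val_neg_of_ne_zero]
    have := t.val_lt
    omega
  obtain hle | hle : t.val ≤ 2 * k + 1 ∨ (-t).val ≤ 2 * k + 1 := by omega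
  · exact Or.inl (eq_one_of_isProgressionWithStep_middleResidues hk ht (hstep ht h) hle)
  · refine Or.inr (neg_eq_iff_eq_neg.1
      (eq_one_of_isProgressionWithStep_middleResidues hk (neg_ne_zero.2 ht)
        (hstep (neg_ne_zero.2 ht) fun m hm => ?_) hle))
    rw [neg_mul, ← mem_neg', neg_middleResidues hk]
    exact h m hm

end MiddleResidues

section Homs

variable {G : Type*} [AddCommGroup G] {p k : ℕ} [Fact p.Prime] {ψ φ : G →+ ZMod p}

theorem surjective_of_ne_zero (hψ : ψ ≠ 0) : Function.Surjective ψ := by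
  obtain ⟨x, hx⟩ := DFunLike.ne_iff.1 hψ
  intro y
  refine ⟨(y * (ψ x)⁻¹).val • x, ?_⟩
  rw [map_nsmul, nsmul_eq_mul, ZMod.natCast_zmod_val, inv_mul_cancel_right₀ hx]

theorem neg_eq_self_iff_eq_two (hψ : ψ ≠ 0) : -ψ = ψ ↔ p = 2 := by
  constructor
  · intro h
    obtain ⟨x, hx⟩ := DFunLike.ne_iff.1 hψ
    have hval : 2 * (ψ x).val = p :=
      ((ZMod.neg_eq_self_iff _).1 (DFunLike.congr_fun h x)).resolve_left hx
    exact ((Nat.prime_dvd_prime_iff_eq Nat.prime_two Fact.out).1 ⟨_, hval.symm⟩).symm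
  · rintro rfl
    ext x
    exact ZMod.neg_eq_self_mod_two _

theorem exists_mul_eq_of_forall_eq_zero (hψ : ψ ≠ 0) (h : ∀ x, ψ x = 0 → φ x = 0) :
    ∃ t, ∀ x, φ x = t * ψ x := by
  obtain ⟨x₁, hx₁⟩ := surjective_of_ne_zero hψ 1
  refine ⟨φ x₁, fun x => ?_⟩
  have hx : φ (x - (ψ x).val • x₁) = 0 := h _ (by simp [hx₁])
  rw [map_sub, map_nsmul, nsmul_eq_mul, ZMod.natCast_zmod_val, sub_eq_zero] at hx
  rw [hx, mul_comm]

theorem eq_zero_of_forall_mem_middleResidues_iff (hk : p = 3 * k + 2) (hψ : ψ ≠ 0)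
    (h : ∀ x, ψ x ∈ middleResidues p k ↔ φ x ∈ middleResidues p k) {x : G} (hx : ψ x = 0) :
    φ x = 0 := by
  by_contra hne
  obtain ⟨m, hm⟩ : (middleResidues p k).Nonempty := by
    rw [← card_pos, card_middleResidues hk]
    omega
  obtain ⟨y, rfl⟩ := surjective_of_ne_zero hψ m
  -- Moving `y` along `x` does not change `ψ y`, but it can bring `φ y` to `0`.
  have hmem : ψ (y + (-φ y * (φ x)⁻¹).val • x) ∈ middleResidues p k := by
    rwa [map_add, map_nsmul, hx, smul_zero, add_zero]
  rw [h, map_add, map_nsmul, nsmul_eq_mul, ZMod.natCast_zmod_val,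
    inv_mul_cancel_right₀ hne, add_neg_cancel] at hmem
  exact (isSumFree_middleResidues hk).zero_notMem hmem

theorem IsSumFree.of_forall_map_mem_middleResidues (hk : p = 3 * k + 2) {A : Finset G}
    (hA : ∀ x ∈ A, ψ x ∈ middleResidues p k) : IsSumFree A := fun x hx y hy hxy =>
  isSumFree_middleResidues hk _ (hA x hx) _ (hA y hy) (map_add ψ x y ▸ hA _ hxy)

variable [Fintype G]

/-- The preimage under `ψ` of the middle residues `{k + 1, …, 2k + 1}`: for `ψ ≠ 0` and
`p = 3k + 2`, a sum-free set of the largest size when `G` is of type I(`p`). -/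
def middlePreimage (k : ℕ) (ψ : G →+ ZMod p) : Finset G :=
  {x | ψ x ∈ middleResidues p k}

theorem mem_middlePreimage {x : G} : x ∈ middlePreimage k ψ ↔ ψ x ∈ middleResidues p k := by
  simp [middlePreimage]

theorem isSumFree_middlePreimage (hk : p = 3 * k + 2) (ψ : G →+ ZMod p) :
    IsSumFree (middlePreimage k ψ) :=
  .of_forall_map_mem_middleResidues hk fun _ => mem_middlePreimage.1

theorem card_middlePreimage_mul (hk : p = 3 * k + 2) (hψ : ψ ≠ 0) :
    #(middlePreimage k ψ) * p = (k + 1) * Fintype.card G := by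
  have h := card_filter_map_mem_mul_card ψ (surjective_of_ne_zero hψ) (middleResidues p k)
  rwa [card_middleResidues hk, ZMod.card] at h

theorem middlePreimage_eq_iff (hk : p = 3 * k + 2) (hψ : ψ ≠ 0) (hφ : φ ≠ 0) :
    middlePreimage k ψ = middlePreimage k φ ↔ φ = ψ ∨ φ = -ψ := by
  constructor
  · intro heq
    have hiff (x : G) : ψ x ∈ middleResidues p k ↔ φ x ∈ middleResidues p k := by
      rw [← mem_middlePreimage, heq, mem_middlePreimage]
    obtain ⟨t, ht⟩ := exists_mul_eq_of_forall_eq_zero hψ fun _ =>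
      eq_zero_of_forall_mem_middleResidues_iff hk hψ hiff
    have ht0 : t ≠ 0 := by
      rintro rfl
      exact hφ (AddMonoidHom.ext fun x => by simp [ht])
    have hmul (m : ZMod p) (hm : m ∈ middleResidues p k) : t * m ∈ middleResidues p k := by
      obtain ⟨x, rfl⟩ := surjective_of_ne_zero hψ m
      rwa [← ht, ← hiff]
    refine (eq_one_or_eq_neg_one_of_mul_mem_middleResidues hk ht0 hmul).imp ?_ ?_ <;>
    · rintro rfl
      ext x
      simp [ht]
  · rintro (rfl | rfl)
    · rfl
    · ext x
      rw [mem_middlePreimage, mem_middlePreimage, AddMonoidHom.neg_apply, ← mem_neg',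
        neg_middleResidues hk]

theorem card_le_mul_card_sdiff [DecidableEq G] (hk : p = 3 * k + 2) (hψ : ψ ≠ 0) (hφ : φ ≠ 0)
    (hne : middlePreimage k ψ ≠ middlePreimage k φ) :
    Fintype.card G ≤ p ^ 2 * #(middlePreimage k ψ \ middlePreimage k φ) := by
  obtain ⟨x, hx⟩ : (middlePreimage k ψ \ middlePreimage k φ).Nonempty := by
    rw [sdiff_nonempty]
    refine fun hsub => hne (eq_of_subset_of_card_le hsub
      (Nat.le_of_mul_le_mul_right ?_ (Fact.out : p.Prime).pos))
    rw [card_middlePreimage_mul hk hψ, card_middlePreimage_mul hk hφ]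
  set f : G →+ ZMod p × ZMod p := ψ.prod φ with hf
  have hcoset : cosetHull f.ker {x} ⊆ middlePreimage k ψ \ middlePreimage k φ := by
    intro y hy
    rw [mem_cosetHull_singleton, AddMonoidHom.mem_ker, map_sub, sub_eq_zero] at hy
    simp only [hf, AddMonoidHom.prod_apply, Prod.mk.injEq] at hy
    rw [mem_sdiff, mem_middlePreimage, mem_middlePreimage] at hx ⊢
    rwa [hy.1, hy.2]
  have hker : Nat.card f.ker ≤ #(middlePreimage k ψ \ middlePreimage k φ) :=
    (card_cosetHull_singleton f.ker x).symm.trans_le (card_le_card hcoset)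
  have hrange : Nat.card f.range ≤ p ^ 2 := by
    refine (AddSubgroup.card_le_card_addGroup f.range).trans_eq ?_
    rw [Nat.card_eq_fintype_card, Fintype.card_prod, ZMod.card, sq]
  calc Fintype.card G = Nat.card f.range * Nat.card f.ker := by
        rw [← Nat.card_eq_fintype_card, ← AddSubgroup.card_mul_index f.ker,
          AddSubgroup.index_ker, mul_comm]
    _ ≤ _ := Nat.mul_le_mul hrange hker

end Homs

section NumOrder

theorem natCard_dual (K V : Type*) [Field K] [AddCommGroup V] [Module K V] [Finite V] :
    Nat.card (Module.Dual K V) = Nat.card V := by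
  rw [Module.natCard_eq_pow_finrank (K := K) (V := Module.Dual K V),
    Module.natCard_eq_pow_finrank (K := K) (V := V), Subspace.dual_finrank_eq]

variable {G : Type*} [AddCommGroup G] {p : ℕ}

/-- Homomorphisms to `ℤ/pℤ` factor through the quotient by the multiples of `p`. -/
def homQuotientEquiv :
    (G →+ ZMod p) ≃ ((G ⧸ (nsmulAddMonoidHom (α := G) p).range) →+ ZMod p) where
  toFun f := QuotientAddGroup.lift _ f (by rintro _ ⟨x, rfl⟩; simp)
  invFun g := g.comp (QuotientAddGroup.mk' _)
  left_inv _ := AddMonoidHom.ext fun _ => rfl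
  right_inv _ := QuotientAddGroup.addMonoidHom_ext _ (AddMonoidHom.ext fun _ => rfl)

variable [Fact p.Prime]

theorem natCard_hom_of_forall_nsmul_eq_zero [Finite G] (h : ∀ x : G, p • x = 0) :
    Nat.card (G →+ ZMod p) = Nat.card G := by
  let _ : Module (ZMod p) G := AddCommGroup.zmodModule h
  exact (Nat.card_congr (AddMonoidHom.toZModLinearMapEquiv p).toEquiv).trans
    (natCard_dual (ZMod p) G)

variable [Fintype G]

theorem natCard_ker_nsmul_eq : Nat.card (nsmulAddMonoidHom (α := G) p).ker = numOrder p G + 1 := by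
  classical
  have hinsert : ({g | p • g = 0} : Finset G) =
      insert 0 ({g | addOrderOf g = p} : Finset G) := by
    ext g
    simp only [mem_filter, mem_univ, true_and, mem_insert, addOrderOf_eq_prime_iff]
    grind [smul_zero]
  have hzero : (0 : G) ∉ ({g | addOrderOf g = p} : Finset G) := by
    simpa using (Fact.out : p.Prime).one_lt.ne
  rw [Nat.card_eq_fintype_card, Fintype.card_subtype]
  simp only [AddMonoidHom.mem_ker, nsmulAddMonoidHom_apply]
  rw [hinsert, card_insert_of_notMem hzero, numOrder]

theorem natCard_hom_eq : Nat.card (G →+ ZMod p) = numOrder p G + 1 := by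
  set f : G →+ G := nsmulAddMonoidHom p
  have hexp (x : G ⧸ f.range) : p • x = 0 := by
    obtain ⟨x, rfl⟩ := QuotientAddGroup.mk_surjective x
    rw [← QuotientAddGroup.mk_nsmul, QuotientAddGroup.eq_zero_iff]
    exact ⟨x, rfl⟩
  have hcard : Nat.card (G ⧸ f.range) = Nat.card f.ker := AddSubgroup.index_range
  rw [Nat.card_congr homQuotientEquiv, natCard_hom_of_forall_nsmul_eq_zero hexp, hcard,
    natCard_ker_nsmul_eq]

theorem numOrder_pos (hp : p ∣ Fintype.card G) : 0 < numOrder p G := by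
  obtain ⟨x, hx⟩ := exists_prime_addOrderOf_dvd_card p hp
  exact card_pos.2 ⟨x, by simpa using hx⟩

theorem numOrder_lt_card : numOrder p G < Fintype.card G := by
  refine card_lt_univ_of_notMem (x := 0) ?_
  simpa using (Fact.out : p.Prime).one_lt.ne

end NumOrder

theorem mem_sumFreeSets {G : Type*} [Add G] [Fintype G] {A : Finset G} :
    A ∈ sumFreeSets G ↔ IsSumFree A := by
  simp [sumFreeSets]

section PairAvoiding

variable {G : Type*} [AddCommGroup G] [DecidableEq G] {x y : G} {Y Z S : Finset G}

/-- The subsets of `S` that contain no pair `{y, y + x}` with `y ∈ Y`. For `Y = S` these are the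
possible traces on `S` of a sum-free set that contains `x`. -/
def pairAvoiding (x : G) (Y S : Finset G) : Finset (Finset G) :=
  {T ∈ S.powerset | ∀ y ∈ Y, y ∈ T → y + x ∉ T}

theorem mem_pairAvoiding {T : Finset G} :
    T ∈ pairAvoiding x Y S ↔ T ⊆ S ∧ ∀ y ∈ Y, y ∈ T → y + x ∉ T := by
  simp [pairAvoiding]

theorem pairAvoiding_anti (h : Y ⊆ Z) : pairAvoiding x Z S ⊆ pairAvoiding x Y S :=
  monotone_filter_right _ fun _ _ hT y hy => hT y (h hy)

theorem card_pairAvoiding_insert_le (x y : G) (Y S : Finset G) :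
    #(pairAvoiding x (insert y Y) S) ≤ 3 * #(pairAvoiding x Y (S \ {y, y + x})) := by
  set P : Finset G := {y, y + x}
  have hP : #(P.powerset.erase P) ≤ 3 := by
    rw [card_erase_of_mem (mem_powerset_self P), card_powerset]
    exact Nat.sub_le_of_le_add (Nat.pow_le_pow_right two_pos card_le_two)
  refine le_trans ?_ (Nat.mul_le_mul_right _ hP)
  rw [← card_product]
  refine card_le_card_of_injOn (fun T => (T ∩ P, T \ P)) ?_ ?_
  · intro T hT
    simp only [mem_coe, mem_pairAvoiding, mem_insert, forall_eq_or_imp] at hT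
    obtain ⟨hTS, hyT, hYT⟩ := hT
    simp only [mem_coe, mem_product, mem_erase, mem_powerset, mem_pairAvoiding]
    refine ⟨⟨?_, inter_subset_right⟩, sdiff_subset_sdiff hTS le_rfl, ?_⟩
    · rw [Ne, inter_eq_right, insert_subset_iff, singleton_subset_iff]
      exact fun h => hyT h.1 h.2
    · exact fun z hz hzT hzxT => hYT z hz (mem_sdiff.1 hzT).1 (mem_sdiff.1 hzxT).1
  · intro T _ T' _ heq
    simp only [Prod.mk.injEq] at heq
    rw [← sdiff_union_inter T P, heq.1, heq.2, sdiff_union_inter]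

theorem card_pairAvoiding_mul_le (x : G) (hY : Y ⊆ S) (hYx : x +ᵥ Y ⊆ S)
    (hdisj : Disjoint Y (x +ᵥ Y)) :
    #(pairAvoiding x Y S) * 4 ^ #Y ≤ 3 ^ #Y * 2 ^ #S := by
  induction Y using Finset.induction_on generalizing S with
  | empty => simp [pairAvoiding]
  | insert y Y hy ih =>
    rw [vadd_finset_insert, vadd_eq_add, add_comm x y] at hYx hdisj
    rw [insert_subset_iff] at hY hYx
    simp only [disjoint_insert_left, disjoint_insert_right, mem_insert, not_or] at hdisj
    obtain ⟨⟨hne, hyxY⟩, hyYx, hdisj⟩ := hdisj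
    have hyxYx : y + x ∉ x +ᵥ Y := by
      rwa [add_comm, ← vadd_eq_add, vadd_mem_vadd_finset_iff]
    have hsdiff {Z : Finset G} (hZ : Z ⊆ S) (hyZ : y ∉ Z) (hyxZ : y + x ∉ Z) :
        Z ⊆ S \ {y, y + x} :=
      subset_sdiff.2 ⟨hZ, disjoint_insert_right.2 ⟨hyZ, disjoint_singleton_right.2 hyxZ⟩⟩
    have ih' := ih (hsdiff hY.2 hy hyxY) (hsdiff hYx.2 hyYx hyxYx) hdisj
    have hS : #(S \ {y, y + x}) + 2 = #S := by
      rw [← card_pair (Ne.symm hne), card_sdiff_add_card_eq_card]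
      simp [insert_subset_iff, hY.1, hYx.1]
    calc #(pairAvoiding x (insert y Y) S) * 4 ^ #(insert y Y)
        ≤ 3 * #(pairAvoiding x Y (S \ {y, y + x})) * 4 ^ #(insert y Y) :=
          Nat.mul_le_mul_right _ (card_pairAvoiding_insert_le x y Y S)
      _ = 12 * (#(pairAvoiding x Y (S \ {y, y + x})) * 4 ^ #Y) := by
          rw [card_insert_of_notMem hy]
          ring
      _ ≤ 12 * (3 ^ #Y * 2 ^ #(S \ {y, y + x})) := Nat.mul_le_mul_left _ ih'
      _ = 3 ^ #(insert y Y) * 2 ^ #S := by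
          rw [card_insert_of_notMem hy, ← hS]
          ring

theorem exists_disjoint_vadd (hx : x ≠ 0) (R : Finset G) :
    ∃ Y ⊆ R, Disjoint Y (x +ᵥ Y) ∧ #R ≤ 3 * #Y := by
  obtain ⟨Y, hY, hmax⟩ := exists_max_image {Y ∈ R.powerset | Disjoint Y (x +ᵥ Y)} card
    ⟨∅, by simp⟩
  obtain ⟨hYR, hdisj⟩ : Y ⊆ R ∧ Disjoint Y (x +ᵥ Y) := by simpa using hY
  refine ⟨Y, hYR, hdisj, ?_⟩
  have hcover : R ⊆ Y ∪ ((x +ᵥ Y) ∪ (-x +ᵥ Y)) := by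
    intro r hr
    by_contra! hcon
    simp only [mem_union, not_or] at hcon
    obtain ⟨hrY, hrYx, hrYx'⟩ := hcon
    have hins : insert r Y ∈ ({Y ∈ R.powerset | Disjoint Y (x +ᵥ Y)} : Finset _) := by
      rw [mem_filter, mem_powerset, insert_subset_iff, vadd_finset_insert, disjoint_insert_left,
        disjoint_insert_right, mem_insert, not_or]
      refine ⟨⟨hr, hYR⟩, ⟨by simpa using hx, hrYx⟩, fun h => hrYx' ?_, hdisj⟩
      rwa [mem_neg_vadd_finset_iff]
    have := hmax _ hins
    rw [card_insert_of_notMem hrY] at this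
    omega
  have hY₁ := card_union_le Y ((x +ᵥ Y) ∪ (-x +ᵥ Y))
  have hY₂ := card_union_le (x +ᵥ Y) (-x +ᵥ Y)
  rw [card_vadd_finset, card_vadd_finset] at hY₂
  have := card_le_card hcover
  omega

theorem card_filter_sdiff_eq_le {𝒜 : Finset (Finset G)} {U : Finset G}
    (h𝒜 : ∀ A ∈ 𝒜, IsSumFree A) (hxU : x ∈ U) :
    #{A ∈ 𝒜 | A \ S = U} ≤ #(pairAvoiding x S S) := by
  refine card_le_card_of_injOn (· ∩ S) ?_ ?_
  · intro A hA
    rw [mem_coe, mem_filter] at hA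
    have hxA : x ∈ A := (mem_sdiff.1 (hA.2 ▸ hxU)).1
    rw [mem_coe, mem_pairAvoiding]
    exact ⟨inter_subset_right, fun y _ hy hyx =>
      h𝒜 A hA.1 y (mem_inter.1 hy).1 x hxA (mem_inter.1 hyx).1⟩
  · intro A hA A' hA' heq
    rw [mem_coe, mem_filter] at hA hA'
    simp only at heq
    rw [← sdiff_union_inter A S, hA.2, heq, ← hA'.2, sdiff_union_inter]

variable [Fintype G] {p k : ℕ} [Fact p.Prime] {ψ : G →+ ZMod p}

theorem three_fourths_pow_le (m : ℕ) : (3 / 4 : ℝ) ^ m ≤ 2 ^ (-(m / 3) : ℝ) := by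
  have hbase : (3 / 4 : ℝ) ≤ 2 ^ (-(1 / 3) : ℝ) := by
    refine le_of_pow_le_pow_left₀ (n := 3) (by norm_num) (by positivity) ?_
    rw [← Real.rpow_mul_natCast (by norm_num)]
    norm_num
  calc (3 / 4 : ℝ) ^ m ≤ (2 ^ (-(1 / 3) : ℝ)) ^ m := pow_le_pow_left₀ (by norm_num) hbase m
    _ = 2 ^ (-(m / 3) : ℝ) := by
        rw [← Real.rpow_mul_natCast (by norm_num)]
        ring_nf

theorem card_pairAvoiding_middlePreimage_le (hk : p = 3 * k + 2) (hψ : ψ ≠ 0) (hx : x ≠ 0)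
    (hxψ : x ∉ middlePreimage k ψ) :
    (#(pairAvoiding x (middlePreimage k ψ) (middlePreimage k ψ)) : ℝ) ≤
      2 ^ (#(middlePreimage k ψ) - Fintype.card G / (9 * p) : ℝ) := by
  have hp : 0 < p := (Fact.out : p.Prime).pos
  set S := middlePreimage k ψ with hS
  obtain ⟨m, hm, hmx⟩ := exists_add_mem_middleResidues hk (mem_middlePreimage.not.1 hxψ)
  have hfiber := card_filter_map_mem_mul_card ψ (surjective_of_ne_zero hψ) {m}
  simp only [mem_singleton, card_singleton, one_mul, ZMod.card] at hfiber
  obtain ⟨Y, hYm, hdisj, hYcard⟩ := exists_disjoint_vadd hx ({y | ψ y = m} : Finset G)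
  replace hYm (y : G) (hy : y ∈ Y) : ψ y = m := by simpa using hYm hy
  have hYS : Y ⊆ S := fun y hy => mem_middlePreimage.2 (by rwa [hYm y hy])
  have hYxS : x +ᵥ Y ⊆ S := by
    intro z hz
    obtain ⟨y, hy, rfl⟩ := mem_vadd_finset.1 hz
    rwa [hS, mem_middlePreimage, vadd_eq_add, add_comm, map_add, hYm y hy]
  have hcount : (#(pairAvoiding x S S) : ℝ) * 4 ^ #Y ≤ 3 ^ #Y * 2 ^ #S := by
    exact_mod_cast (Nat.mul_le_mul_right _ (card_le_card (pairAvoiding_anti hYS))).trans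
      (card_pairAvoiding_mul_le x hYS hYxS hdisj)
  have hY : (Fintype.card G / (9 * p) : ℝ) ≤ #Y / 3 := by
    rw [div_le_div_iff₀ (by positivity) (by norm_num)]
    have : Fintype.card G * 3 ≤ #Y * (9 * p) := by nlinarith
    exact_mod_cast this
  calc (#(pairAvoiding x S S) : ℝ) ≤ (3 / 4) ^ #Y * 2 ^ #S := by
        rwa [div_pow, div_mul_eq_mul_div, le_div_iff₀ (by positivity)]
    _ ≤ 2 ^ (-(#Y / 3) : ℝ) * 2 ^ #S := by
        gcongr
        exact three_fourths_pow_le _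
    _ = 2 ^ (#S - #Y / 3 : ℝ) := by
        rw [← Real.rpow_natCast, ← Real.rpow_add two_pos, neg_add_eq_sub]
    _ ≤ _ := Real.rpow_le_rpow_of_exponent_le one_le_two (by linarith)

/-- The sum-free sets that are not contained in `ψ⁻¹({k + 1, …, 2k + 1})`, but have at most
`τ |G|` elements outside it. -/
noncomputable def nearMiddlePreimage (k : ℕ) (ψ : G →+ ZMod p) (τ : ℝ) : Finset (Finset G) :=
  {A ∈ sumFreeSets G | ¬ A ⊆ middlePreimage k ψ ∧
    (#(A \ middlePreimage k ψ) : ℝ) ≤ τ * Fintype.card G}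

theorem mem_nearMiddlePreimage {τ : ℝ} {A : Finset G} :
    A ∈ nearMiddlePreimage k ψ τ ↔ IsSumFree A ∧ ¬ A ⊆ middlePreimage k ψ ∧
      (#(A \ middlePreimage k ψ) : ℝ) ≤ τ * Fintype.card G := by
  rw [nearMiddlePreimage, mem_filter, mem_sumFreeSets]

theorem card_nearMiddlePreimage_le (hk : p = 3 * k + 2) (hψ : ψ ≠ 0) (τ : ℝ) :
    (#(nearMiddlePreimage k ψ τ) : ℝ) ≤ #{U : Finset G | (#U : ℝ) ≤ τ * Fintype.card G} *
      2 ^ (#(middlePreimage k ψ) - Fintype.card G / (9 * p) : ℝ) := by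
  set S := middlePreimage k ψ
  set 𝒜 := nearMiddlePreimage k ψ τ
  have hmaps : ∀ A ∈ 𝒜, A \ S ∈ ({U | (#U : ℝ) ≤ τ * Fintype.card G} : Finset (Finset G)) :=
    fun A hA => mem_filter.2 ⟨mem_univ _, (mem_nearMiddlePreimage.1 hA).2.2⟩
  rw [card_eq_sum_card_fiberwise hmaps, Nat.cast_sum, ← nsmul_eq_mul]
  refine sum_le_card_nsmul _ _ _ fun U _ => ?_
  obtain hempty | ⟨A, hA⟩ := ({A ∈ 𝒜 | A \ S = U} : Finset _).eq_empty_or_nonempty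
  · rw [hempty, card_empty, Nat.cast_zero]
    positivity
  obtain ⟨hA𝒜, rfl⟩ := mem_filter.1 hA
  obtain ⟨hAsf, hAS, -⟩ := mem_nearMiddlePreimage.1 hA𝒜
  obtain ⟨x, hxA, hxS⟩ := not_subset.1 hAS
  have hx : x ≠ 0 := by
    rintro rfl
    exact hAsf.zero_notMem hxA
  refine le_trans ?_ (card_pairAvoiding_middlePreimage_le hk hψ hx hxS)
  exact_mod_cast card_filter_sdiff_eq_le
    (fun A hA => (mem_nearMiddlePreimage.1 hA).1) (mem_sdiff.2 ⟨hxA, hxS⟩)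

end PairAvoiding

section Bonferroni

variable {ι α : Type*} [DecidableEq α]

theorem sum_card_le_card_biUnion_add (s : Finset ι) (f : ι → Finset α) :
    ∑ i ∈ s, #(f i) ≤ #(s.biUnion f) + ∑ ij ∈ s.offDiag, #(f ij.1 ∩ f ij.2) := by
  classical
  induction s using Finset.induction_on with
  | empty => simp
  | insert a s ha ih =>
    have hunion := card_union_add_card_inter (f a) (s.biUnion f)
    have hinter : #(f a ∩ s.biUnion f) ≤ ∑ j ∈ s, #(f a ∩ f j) := by
      rw [inter_biUnion]
      exact card_biUnion_le
    have hoffDiag : ∑ j ∈ s, #(f a ∩ f j) + ∑ ij ∈ s.offDiag, #(f ij.1 ∩ f ij.2) ≤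
        ∑ ij ∈ (insert a s).offDiag, #(f ij.1 ∩ f ij.2) := by
      have hdisj : Disjoint ({a} ×ˢ s) s.offDiag := disjoint_left.2 fun ij hij hij' =>
        ha (mem_singleton.1 (mem_product.1 hij).1 ▸ (mem_offDiag.1 hij').1)
      calc _ = ∑ ij ∈ {a} ×ˢ s ∪ s.offDiag, #(f ij.1 ∩ f ij.2) := by
            rw [sum_union hdisj, sum_product, sum_singleton]
        _ ≤ _ := sum_le_sum_of_subset (by
            rw [offDiag_insert ha, union_comm]
            exact subset_union_left)
    rw [sum_insert ha, biUnion_insert]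
    omega

theorem abs_card_biUnion_powerset_sub_le {𝒮 : Finset (Finset α)} {s t : ℝ}
    (hs : ∀ S ∈ 𝒮, (#S : ℝ) = s)
    (ht : ∀ S ∈ 𝒮, ∀ T ∈ 𝒮, S ≠ T → (#(S ∩ T) : ℝ) ≤ t) :
    |(#(𝒮.biUnion powerset) : ℝ) - #𝒮 * 2 ^ s| ≤ #𝒮 * (#𝒮 * 2 ^ t) := by
  have hsum : ∑ S ∈ 𝒮, (#S.powerset : ℝ) = #𝒮 * 2 ^ s := by
    rw [← nsmul_eq_mul]
    refine sum_eq_card_nsmul fun S hS => ?_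
    rw [card_powerset, ← hs S hS, Real.rpow_natCast]
    push_cast
    rfl
  have hupper : (#(𝒮.biUnion powerset) : ℝ) ≤ ∑ S ∈ 𝒮, (#S.powerset : ℝ) := by
    exact_mod_cast card_biUnion_le
  have hlower : ∑ S ∈ 𝒮, (#S.powerset : ℝ) ≤ #(𝒮.biUnion powerset) +
      ∑ ST ∈ 𝒮.offDiag, (#(ST.1.powerset ∩ ST.2.powerset) : ℝ) := by
    exact_mod_cast sum_card_le_card_biUnion_add 𝒮 powerset
  have hinter : ∑ ST ∈ 𝒮.offDiag, (#(ST.1.powerset ∩ ST.2.powerset) : ℝ) ≤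
      #𝒮 * (#𝒮 * 2 ^ t) := by
    calc _ ≤ #𝒮.offDiag • (2 : ℝ) ^ t := sum_le_card_nsmul _ _ _ fun ST hST => by
          obtain ⟨hS, hT, hne⟩ := mem_offDiag.1 hST
          have hpowerset : ST.1.powerset ∩ ST.2.powerset = (ST.1 ∩ ST.2).powerset := by
            ext
            simp only [mem_inter, mem_powerset, subset_inter_iff]
          rw [hpowerset, card_powerset, Nat.cast_pow, Nat.cast_ofNat, ← Real.rpow_natCast]
          exact Real.rpow_le_rpow_of_exponent_le one_le_two (ht _ hS _ hT hne)
      _ ≤ #𝒮 * (#𝒮 * 2 ^ t) := by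
          rw [nsmul_eq_mul, ← mul_assoc]
          gcongr
          rw [offDiag_card]
          exact_mod_cast Nat.sub_le _ _
  rw [abs_le]
  constructor <;> linarith

end Bonferroni

section MaximalSumFree

variable {p k : ℕ} [Fact p.Prime] {G : Type*} [AddCommGroup G] [Fintype G]

theorem IsTypeI.exists_hom_ne_zero (hG : IsTypeI p G) : ∃ ψ : G →+ ZMod p, ψ ≠ 0 := by
  have hcard : 1 < Nat.card (G →+ ZMod p) := by
    rw [natCard_hom_eq]
    exact Nat.succ_lt_succ (numOrder_pos hG.1.2.2)
  have : Finite (G →+ ZMod p) := DFunLike.finite _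
  have : Nontrivial (G →+ ZMod p) := Finite.one_lt_card_iff_nontrivial.1 hcard
  exact exists_ne 0

theorem IsTypeI.sup_card_sumFreeSets_mul (hk : p = 3 * k + 2) (hG : IsTypeI p G) :
    (sumFreeSets G).sup card * p = (k + 1) * Fintype.card G := by
  obtain ⟨ψ, hψ⟩ := hG.exists_hom_ne_zero
  have hψmem := mem_sumFreeSets.2 (isSumFree_middlePreimage hk ψ)
  apply le_antisymm
  · obtain ⟨A, hA, hAsup⟩ := exists_mem_eq_sup (sumFreeSets G) ⟨_, hψmem⟩ card
    exact hAsup ▸ (mem_sumFreeSets.1 hA).card_mul_le hk hG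
  · rw [← card_middlePreimage_mul hk hψ]
    exact Nat.mul_le_mul_right _ (le_sup (f := card) hψmem)

theorem IsTypeI.sumFreeDensity_eq (hk : p = 3 * k + 2) (hG : IsTypeI p G) :
    sumFreeDensity G = (p + 1) / (3 * p) := by
  have hp : (p : ℝ) ≠ 0 := by exact_mod_cast (Fact.out : p.Prime).ne_zero
  have hn : (Fintype.card G : ℝ) ≠ 0 := by exact_mod_cast Fintype.card_ne_zero
  have hsup : (((sumFreeSets G).sup card : ℕ) : ℝ) * p = (k + 1) * Fintype.card G := by
    exact_mod_cast hG.sup_card_sumFreeSets_mul hk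
  have hpk : (p : ℝ) + 1 = 3 * (k + 1) := by
    rw [hk]
    push_cast
    ring
  rw [sumFreeDensity, div_eq_div_iff hn (by positivity), hpk]
  linear_combination 3 * hsup

theorem IsTypeI.card_middlePreimage (hk : p = 3 * k + 2) (hG : IsTypeI p G) {ψ : G →+ ZMod p}
    (hψ : ψ ≠ 0) : (#(middlePreimage k ψ) : ℝ) = sumFreeDensity G * Fintype.card G := by
  have hn : (Fintype.card G : ℝ) ≠ 0 := by exact_mod_cast Fintype.card_ne_zero
  rw [sumFreeDensity, div_mul_cancel₀ _ hn, Nat.cast_inj]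
  refine Nat.eq_of_mul_eq_mul_right (Fact.out : p.Prime).pos ?_
  rw [card_middlePreimage_mul hk hψ, hG.sup_card_sumFreeSets_mul hk]

theorem IsTypeI.card_inter_middlePreimage_le [DecidableEq G] (hk : p = 3 * k + 2)
    (hG : IsTypeI p G) {ψ φ : G →+ ZMod p} (hψ : ψ ≠ 0) (hφ : φ ≠ 0)
    (hne : middlePreimage k ψ ≠ middlePreimage k φ) :
    (#(middlePreimage k ψ ∩ middlePreimage k φ) : ℝ) ≤
      (sumFreeDensity G - 1 / p ^ 2) * Fintype.card G := by
  have hp : (0 : ℝ) < p := by exact_mod_cast (Fact.out : p.Prime).pos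
  have hsdiff : (1 / p ^ 2 : ℝ) * Fintype.card G ≤
      #(middlePreimage k ψ \ middlePreimage k φ) := by
    rw [one_div_mul_eq_div, div_le_iff₀' (by positivity)]
    exact_mod_cast card_le_mul_card_sdiff hk hψ hφ hne
  have hsum : (#(middlePreimage k ψ \ middlePreimage k φ) : ℝ) +
      #(middlePreimage k ψ ∩ middlePreimage k φ) = sumFreeDensity G * Fintype.card G := by
    rw [← hG.card_middlePreimage hk hψ]
    exact_mod_cast card_sdiff_add_card_inter _ _
  linarith

end MaximalSumFree

theorem exists_nat_mul_two_rpow_le {c ε : ℝ} (hc : 0 < c) (hε : 0 < ε) :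
    ∃ N : ℕ, ∀ n : ℕ, N ≤ n → ∀ a : ℝ, n * (2 : ℝ) ^ ((a - c) * n) ≤ ε * 2 ^ (a * n) := by
  have hlt : (2 : ℝ) ^ (-c) < 1 :=
    Real.rpow_lt_one_of_one_lt_of_neg one_lt_two (neg_lt_zero.2 hc)
  obtain ⟨N, hN⟩ := Filter.eventually_atTop.1
    ((tendsto_self_mul_const_pow_of_lt_one (by positivity) hlt).eventually_lt_const hε)
  refine ⟨N, fun n hn a => ?_⟩
  calc n * (2 : ℝ) ^ ((a - c) * n) = n * ((2 : ℝ) ^ (-c)) ^ n * 2 ^ (a * n) := by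
        rw [← Real.rpow_mul_natCast two_pos.le, mul_assoc, ← Real.rpow_add two_pos]
        ring_nf
    _ ≤ ε * 2 ^ (a * n) := by
        gcongr
        exact (hN n hn).le

section Exceptional

universe u

variable {p k : ℕ} [Fact p.Prime]

theorem mem_exceptionalSumFreeSets {p k : ℕ} {G : Type*} [AddCommGroup G] [Fintype G]
    {A : Finset G} : A ∈ exceptionalSumFreeSets p k G ↔
      IsSumFree A ∧ ¬ ∃ ψ : G →+ ZMod p, ∀ x ∈ A, ψ x ∈ middleResidues p k := by
  simp only [exceptionalSumFreeSets, mem_filter, mem_sumFreeSets]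

theorem exists_card_sdiff_middlePreimage_le (hk : p = 3 * k + 2) {τ : ℝ} (hτ : 0 < τ) :
    ∃ δ > 0, ∀ (G : Type u) [AddCommGroup G] [Fintype G] [DecidableEq G], IsTypeI p G →
      ∀ F : Finset G, (#(schurPairs F) : ℝ) < δ * (Fintype.card G) ^ 2 →
        (sumFreeDensity G - 1 / (6 * p * (p + 1))) * Fintype.card G < #F →
          ∃ ψ : G →+ ZMod p, ψ ≠ 0 ∧ (#(F \ middlePreimage k ψ) : ℝ) ≤ τ * Fintype.card G := by
  have hp : (0 : ℝ) < p := by exact_mod_cast (Fact.out : p.Prime).pos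
  obtain ⟨δ, hδ, hremoval⟩ := exists_isSumFree_of_card_schurPairs_lt.{u}
    (lt_min hτ (by positivity : 0 < (1 / (6 * p * (p + 1)) : ℝ)))
  refine ⟨δ, hδ, fun G _ _ _ hG F hF hFcard => ?_⟩
  obtain ⟨B, hBF, hBsf, hFB⟩ := hremoval G F hF
  rw [min_mul_of_nonneg _ _ (Nat.cast_nonneg _), le_min_iff] at hFB
  have hB : (sumFreeDensity G - 1 / (3 * p * (p + 1))) * Fintype.card G < #B := by
    have hsum : (#(F \ B) : ℝ) + #B = #F := by exact_mod_cast card_sdiff_add_card_eq_card hBF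
    have hhalf : (1 / (3 * p * (p + 1)) : ℝ) = 2 * (1 / (6 * p * (p + 1))) := by
      field_simp
      norm_num
    rw [hhalf]
    linarith
  have hdensity : sumFreeDensity G - 1 / (3 * p * (p + 1)) = (p + 2) / (3 * (p + 1)) := by
    rw [hG.sumFreeDensity_eq hk]
    field_simp
    ring
  have hBcard : (p + 2) * Fintype.card G < 3 * (p + 1) * #B := by
    rw [hdensity, div_mul_eq_mul_div, div_lt_iff₀' (by positivity)] at hB
    exact_mod_cast hB
  obtain ⟨ψ, hψ⟩ := hBsf.exists_hom Fact.out hk hG hBcard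
  refine ⟨ψ, ?_, le_trans ?_ hFB.1⟩
  · rintro rfl
    obtain rfl : B = ∅ := eq_empty_of_forall_notMem fun b hb =>
      (isSumFree_middleResidues hk).zero_notMem (hψ b hb)
    simp at hBcard
  · exact_mod_cast card_le_card
      (sdiff_subset_sdiff le_rfl fun x hx => mem_middlePreimage.2 (hψ x hx))

theorem card_biUnion_powerset_le {α : Type*} [DecidableEq α] {𝓕 : Finset (Finset α)} {s t : ℝ}
    (hcard : (#𝓕 : ℝ) ≤ 2 ^ t) (hs : ∀ F ∈ 𝓕, (#F : ℝ) ≤ s) :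
    (#(𝓕.biUnion powerset) : ℝ) ≤ 2 ^ (t + s) := by
  calc (#(𝓕.biUnion powerset) : ℝ) ≤ ∑ F ∈ 𝓕, (#F.powerset : ℝ) := by
        exact_mod_cast card_biUnion_le
    _ ≤ #𝓕 • (2 : ℝ) ^ s := sum_le_card_nsmul _ _ _ fun F hF => by
        rw [card_powerset, Nat.cast_pow, Nat.cast_ofNat, ← Real.rpow_natCast]
        exact Real.rpow_le_rpow_of_exponent_le one_le_two (hs F hF)
    _ ≤ 2 ^ (t + s) := by
        rw [nsmul_eq_mul, Real.rpow_add two_pos]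
        gcongr

variable {G : Type*} [AddCommGroup G] [Fintype G]

open Classical in
/-- The union over all `ψ ≠ 0` of the families `nearMiddlePreimage k ψ τ`. -/
noncomputable def nearMiddlePreimages (p k : ℕ) [Fact p.Prime] (G : Type*) [AddCommGroup G]
    [Fintype G] (τ : ℝ) : Finset (Finset G) :=
  {A | ∃ ψ : G →+ ZMod p, ψ ≠ 0 ∧ A ∈ nearMiddlePreimage k ψ τ}

theorem mem_nearMiddlePreimages {τ : ℝ} {A : Finset G} [DecidableEq G] :
    A ∈ nearMiddlePreimages p k G τ ↔
      ∃ ψ : G →+ ZMod p, ψ ≠ 0 ∧ A ∈ nearMiddlePreimage k ψ τ := by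
  simp only [nearMiddlePreimages, mem_filter, mem_univ, true_and]
  convert Iff.rfl

theorem card_nearMiddlePreimages_le (hk : p = 3 * k + 2) (hG : IsTypeI p G) {τ γ : ℝ}
    (hτ : (#{U : Finset G | (#U : ℝ) ≤ τ * Fintype.card G} : ℝ) ≤ 2 ^ (γ * Fintype.card G)) :
    (#(nearMiddlePreimages p k G τ) : ℝ) ≤
      Fintype.card G * 2 ^ ((sumFreeDensity G + γ - 1 / (9 * p)) * Fintype.card G) := by
  classical
  have : Finite (G →+ ZMod p) := DFunLike.finite _
  let _ : Fintype (G →+ ZMod p) := Fintype.ofFinite _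
  set H : Finset (G →+ ZMod p) := {ψ | ψ ≠ 0}
  have hH : #H ≤ Fintype.card G := by
    refine (card_le_univ H).trans ?_
    rw [← Nat.card_eq_fintype_card, natCard_hom_eq]
    exact numOrder_lt_card
  have hunion : nearMiddlePreimages p k G τ = H.biUnion (nearMiddlePreimage k · τ) := by
    ext A
    simp [mem_nearMiddlePreimages, H]
  rw [hunion]
  calc (#(H.biUnion (nearMiddlePreimage k · τ)) : ℝ)
      ≤ ∑ ψ ∈ H, (#(nearMiddlePreimage k ψ τ) : ℝ) := by exact_mod_cast card_biUnion_le
    _ ≤ #H • (2 : ℝ) ^ ((sumFreeDensity G + γ - 1 / (9 * p)) * Fintype.card G) := by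
        refine sum_le_card_nsmul _ _ _ fun ψ hψ => ?_
        have hψ0 : ψ ≠ 0 := (mem_filter.1 hψ).2
        refine (card_nearMiddlePreimage_le hk hψ0 τ).trans
          ((mul_le_mul_of_nonneg_right hτ (by positivity)).trans_eq ?_)
        rw [← Real.rpow_add two_pos, hG.card_middlePreimage hk hψ0]
        ring_nf
    _ ≤ _ := by
        rw [nsmul_eq_mul]
        gcongr

theorem exceptionalSumFreeSets_subset_union [DecidableEq G] {𝓕 : Finset (Finset G)}
    (h𝓕 : IsContainerFamily 𝓕 univ) {s τ : ℝ}
    (hstable : ∀ F ∈ 𝓕, s < #F →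
      ∃ ψ : G →+ ZMod p, ψ ≠ 0 ∧ (#(F \ middlePreimage k ψ) : ℝ) ≤ τ * Fintype.card G) :
    exceptionalSumFreeSets p k G ⊆
      {F ∈ 𝓕 | (#F : ℝ) ≤ s}.biUnion powerset ∪ nearMiddlePreimages p k G τ := by
  intro A hA
  obtain ⟨hAsf, hAex⟩ := mem_exceptionalSumFreeSets.1 hA
  obtain ⟨F, hF, hAF⟩ := h𝓕 A (subset_univ A) hAsf
  rw [mem_union]
  by_cases hFs : (#F : ℝ) ≤ s
  · exact .inl (mem_biUnion.2 ⟨F, mem_filter.2 ⟨hF, hFs⟩, mem_powerset.2 hAF⟩)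
  · obtain ⟨ψ, hψ, hFψ⟩ := hstable F hF (not_le.1 hFs)
    refine .inr (mem_nearMiddlePreimages.2 ⟨ψ, hψ, mem_nearMiddlePreimage.2 ⟨hAsf, ?_, ?_⟩⟩)
    · exact fun hAψ => hAex ⟨ψ, fun x hx => mem_middlePreimage.1 (hAψ hx)⟩
    · refine le_trans ?_ hFψ
      exact_mod_cast card_le_card (sdiff_subset_sdiff hAF le_rfl)

theorem exists_card_exceptionalSumFreeSets_le (hk : p = 3 * k + 2) :
    ∃ c > 0, ∃ N : ℕ, ∀ (G : Type u) [AddCommGroup G] [Fintype G], IsTypeI p G →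
      N ≤ Fintype.card G → (#(exceptionalSumFreeSets p k G) : ℝ) ≤
        2 * (Fintype.card G * 2 ^ ((sumFreeDensity G - c) * Fintype.card G)) := by
  have hp : (0 : ℝ) < p := by exact_mod_cast (Fact.out : p.Prime).pos
  obtain ⟨c, hc, hcγ, h2c⟩ : ∃ c : ℝ, 0 < c ∧ c < 1 / (9 * p) ∧ 1 / (6 * p * (p + 1)) = 2 * c := by
    refine ⟨1 / (12 * p * (p + 1)), by positivity, ?_, by field_simp; norm_num⟩
    exact one_div_lt_one_div_of_lt (by positivity) (by nlinarith)
  obtain ⟨τ, hτ, hsmall⟩ := exists_card_subsets_card_le.{u} (sub_pos.2 hcγ)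
  obtain ⟨δ, hδ, hstable⟩ := exists_card_sdiff_middlePreimage_le.{u} hk hτ
  obtain ⟨N, hN⟩ := exists_isContainerFamily.{u} (half_pos hδ) hc
  rw [h2c] at hstable
  refine ⟨c, hc, N, fun G _ _ hG hNG => ?_⟩
  classical
  obtain ⟨𝓕, h𝓕card, h𝓕schur, h𝓕⟩ := hN G hNG
  have hn : (1 : ℝ) ≤ Fintype.card G := by exact_mod_cast Fintype.card_pos
  set n : ℝ := (Fintype.card G : ℝ)
  set 𝓕₀ : Finset (Finset G) := {F ∈ 𝓕 | (#F : ℝ) ≤ (sumFreeDensity G - 2 * c) * n}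
  have hcover : exceptionalSumFreeSets p k G ⊆
      𝓕₀.biUnion powerset ∪ nearMiddlePreimages p k G τ :=
    exceptionalSumFreeSets_subset_union h𝓕 fun F hF =>
      hstable G hG F ((h𝓕schur F hF).trans_lt (by gcongr; exact half_lt_self hδ))
  have hsmallContainers : (#(𝓕₀.biUnion powerset) : ℝ) ≤ 2 ^ ((sumFreeDensity G - c) * n) := by
    refine (card_biUnion_powerset_le (le_trans ?_ h𝓕card) fun F hF => (mem_filter.1 hF).2).trans_eq
      (by ring_nf)
    exact_mod_cast card_filter_le _ _
  have hnear : (#(nearMiddlePreimages p k G τ) : ℝ) ≤ n * 2 ^ ((sumFreeDensity G - c) * n) := by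
    have hexp : sumFreeDensity G + (1 / (9 * p) - c) - 1 / (9 * p) = sumFreeDensity G - c := by
      ring
    simpa only [hexp] using card_nearMiddlePreimages_le hk hG (hsmall G)
  calc (#(exceptionalSumFreeSets p k G) : ℝ) ≤ _ + _ := by
        exact_mod_cast (card_le_card hcover).trans (card_union_le _ _)
    _ ≤ n * 2 ^ ((sumFreeDensity G - c) * n) + n * 2 ^ ((sumFreeDensity G - c) * n) :=
        add_le_add (hsmallContainers.trans (le_mul_of_one_le_left (by positivity) hn)) hnear
    _ = _ := (two_mul _).symm

theorem exists_card_exceptionalSumFreeSets_le_mul (hk : p = 3 * k + 2) {ε : ℝ} (hε : 0 < ε) :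
    ∃ N : ℕ, ∀ (G : Type u) [AddCommGroup G] [Fintype G], IsTypeI p G → N ≤ Fintype.card G →
      (#(exceptionalSumFreeSets p k G) : ℝ) ≤ ε * 2 ^ (sumFreeDensity G * Fintype.card G) := by
  obtain ⟨c, hc, N₁, hN₁⟩ := exists_card_exceptionalSumFreeSets_le.{u} hk
  obtain ⟨N₂, hN₂⟩ := exists_nat_mul_two_rpow_le hc (half_pos hε)
  refine ⟨max N₁ N₂, fun G _ _ hG hN => (hN₁ G hG ((le_max_left _ _).trans hN)).trans ?_⟩
  linarith [hN₂ _ ((le_max_right _ _).trans hN) (sumFreeDensity G)]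

end Exceptional

section MiddlePreimages

variable {p k : ℕ} [Fact p.Prime] {G : Type*} [AddCommGroup G] [Fintype G]

open Classical in
/-- The family of all sets `middlePreimage k ψ` with `ψ ≠ 0`. -/
noncomputable def middlePreimages (p k : ℕ) [Fact p.Prime] (G : Type*) [AddCommGroup G]
    [Fintype G] : Finset (Finset G) :=
  {S | ∃ ψ : G →+ ZMod p, ψ ≠ 0 ∧ middlePreimage k ψ = S}

theorem mem_middlePreimages {S : Finset G} :
    S ∈ middlePreimages p k G ↔ ∃ ψ : G →+ ZMod p, ψ ≠ 0 ∧ middlePreimage k ψ = S := by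
  simp [middlePreimages]

theorem card_filter_middlePreimage_eq [Fintype (G →+ ZMod p)] [DecidableEq (G →+ ZMod p)]
    [DecidableEq G] (hk : p = 3 * k + 2) {ψ : G →+ ZMod p} (hψ : ψ ≠ 0) :
    #{φ ∈ ({0}ᶜ : Finset (G →+ ZMod p)) | middlePreimage k φ = middlePreimage k ψ} =
      if p = 2 then 1 else 2 := by
  have hfiber : {φ ∈ ({0}ᶜ : Finset (G →+ ZMod p)) | middlePreimage k φ = middlePreimage k ψ} =
      {ψ, -ψ} := by
    ext φ
    simp only [mem_filter, mem_compl, mem_insert, mem_singleton]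
    constructor
    · rintro ⟨hφ, heq⟩
      exact (middlePreimage_eq_iff hk hψ hφ).1 heq.symm
    · intro h
      have hφ : φ ≠ 0 := by rcases h with rfl | rfl <;> simpa using hψ
      exact ⟨hφ, ((middlePreimage_eq_iff hk hψ hφ).2 h).symm⟩
  rw [hfiber]
  split_ifs with hp
  · rw [(neg_eq_self_iff_eq_two hψ).2 hp, pair_eq_singleton, card_singleton]
  · exact card_pair fun h => hp ((neg_eq_self_iff_eq_two hψ).1 h.symm)

theorem card_middlePreimages_mul (hk : p = 3 * k + 2) :
    #(middlePreimages p k G) * (if p = 2 then 1 else 2) = numOrder p G := by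
  classical
  have : Finite (G →+ ZMod p) := DFunLike.finite _
  let _ : Fintype (G →+ ZMod p) := Fintype.ofFinite _
  have hcard : #({0}ᶜ : Finset (G →+ ZMod p)) = numOrder p G := by
    rw [card_compl, card_singleton, ← Nat.card_eq_fintype_card, natCard_hom_eq,
      Nat.add_sub_cancel]
  have himage : middlePreimages p k G = ({0}ᶜ : Finset (G →+ ZMod p)).image (middlePreimage k) := by
    ext S
    simp [mem_middlePreimages]
  rw [← hcard, himage, card_eq_sum_card_image (middlePreimage k)]
  refine (sum_const_nat fun S hS => ?_).symm
  obtain ⟨ψ, hψ, rfl⟩ := mem_image.1 hS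
  exact card_filter_middlePreimage_eq hk (by simpa using hψ)

theorem card_middlePreimages (hk : p = 3 * k + 2) :
    (#(middlePreimages p k G) : ℝ) = (if p = 2 then (1 : ℝ) else 1 / 2) * numOrder p G := by
  rw [← card_middlePreimages_mul hk]
  split_ifs <;> push_cast <;> ring

theorem card_middlePreimages_le (hk : p = 3 * k + 2) :
    #(middlePreimages p k G) ≤ Fintype.card G := by
  refine le_trans (Nat.le_mul_of_pos_right _ ?_)
    ((card_middlePreimages_mul hk).trans_le numOrder_lt_card.le)
  split_ifs <;> norm_num

theorem IsTypeI.middlePreimages_nonempty (hG : IsTypeI p G) :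
    (middlePreimages p k G).Nonempty := by
  obtain ⟨ψ, hψ⟩ := hG.exists_hom_ne_zero
  exact ⟨_, mem_middlePreimages.2 ⟨ψ, hψ, rfl⟩⟩

theorem IsTypeI.card_sumFreeSets_eq_add [DecidableEq G] (hk : p = 3 * k + 2) (hG : IsTypeI p G) :
    #(sumFreeSets G) = #((middlePreimages p k G).biUnion powerset) +
      #(exceptionalSumFreeSets p k G) := by
  classical
  have hgood : {A ∈ sumFreeSets G | ∃ ψ : G →+ ZMod p, ∀ x ∈ A, ψ x ∈ middleResidues p k} =
      (middlePreimages p k G).biUnion powerset := by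
    ext A
    simp only [mem_filter, mem_biUnion, mem_powerset, mem_sumFreeSets]
    constructor
    · rintro ⟨-, ψ, hψ⟩
      obtain rfl | hψ0 := eq_or_ne ψ 0
      · obtain ⟨S, hS⟩ := hG.middlePreimages_nonempty (k := k)
        exact ⟨S, hS, fun x hx => absurd (hψ x hx) (isSumFree_middleResidues hk).zero_notMem⟩
      · exact ⟨_, mem_middlePreimages.2 ⟨ψ, hψ0, rfl⟩, fun x hx => mem_middlePreimage.2 (hψ x hx)⟩
    · rintro ⟨S, hS, hAS⟩
      obtain ⟨ψ, -, rfl⟩ := mem_middlePreimages.1 hS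
      have hA (x) (hx : x ∈ A) : ψ x ∈ middleResidues p k := mem_middlePreimage.1 (hAS hx)
      exact ⟨.of_forall_map_mem_middleResidues hk hA, ψ, hA⟩
  rw [← hgood, exceptionalSumFreeSets]
  convert (card_filter_add_card_filter_not (s := sumFreeSets G) fun A =>
    ∃ ψ : G →+ ZMod p, ∀ x ∈ A, ψ x ∈ middleResidues p k).symm

theorem exists_abs_card_biUnion_middlePreimages_sub_le (hk : p = 3 * k + 2) {ε : ℝ} (hε : 0 < ε) :
    ∃ N : ℕ, ∀ (G : Type*) [AddCommGroup G] [Fintype G] [DecidableEq G], IsTypeI p G →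
      N ≤ Fintype.card G →
        |(#((middlePreimages p k G).biUnion powerset) : ℝ) -
            #(middlePreimages p k G) * 2 ^ (sumFreeDensity G * Fintype.card G)| ≤
          ε * (#(middlePreimages p k G) * 2 ^ (sumFreeDensity G * Fintype.card G)) := by
  have hp : (0 : ℝ) < p := by exact_mod_cast (Fact.out : p.Prime).pos
  obtain ⟨N, hN⟩ := exists_nat_mul_two_rpow_le (c := 1 / p ^ 2) (by positivity) hε
  refine ⟨N, fun G _ _ _ hG hNG => ?_⟩
  calc |(#((middlePreimages p k G).biUnion powerset) : ℝ) -
          #(middlePreimages p k G) * 2 ^ (sumFreeDensity G * Fintype.card G)|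
      ≤ #(middlePreimages p k G) * (#(middlePreimages p k G) *
          2 ^ ((sumFreeDensity G - 1 / p ^ 2) * Fintype.card G)) := by
        refine abs_card_biUnion_powerset_sub_le (fun S hS => ?_) fun S hS T hT hST => ?_
        · obtain ⟨ψ, hψ, rfl⟩ := mem_middlePreimages.1 hS
          exact hG.card_middlePreimage hk hψ
        · obtain ⟨ψ, hψ, rfl⟩ := mem_middlePreimages.1 hS
          obtain ⟨φ, hφ, rfl⟩ := mem_middlePreimages.1 hT
          exact hG.card_inter_middlePreimage_le hk hψ hφ hST
    _ ≤ #(middlePreimages p k G) * (ε * 2 ^ (sumFreeDensity G * Fintype.card G)) := by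
        refine mul_le_mul_of_nonneg_left (le_trans ?_ (hN _ hNG _)) (Nat.cast_nonneg _)
        gcongr
        exact card_middlePreimages_le hk
    _ = _ := mul_left_comm _ _ _

end MiddlePreimages

theorem theorem3 (p k : ℕ) (hp : p.Prime) (hk : p = 3 * k + 2) (ε : ℝ) (hε : 0 < ε) :
    ∃ N : ℕ, ∀ (G : Type*) [AddCommGroup G] [Fintype G],
      IsTypeI p G → N ≤ Fintype.card G →
        |((sumFreeSets G).card : ℝ) -
            (if p = 2 then (1 : ℝ) else 1 / 2) * (numOrder p G : ℝ) *
              (2 : ℝ) ^ (sumFreeDensity G * (Fintype.card G : ℝ))| ≤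
          ε * ((if p = 2 then (1 : ℝ) else 1 / 2) * (numOrder p G : ℝ) *
              (2 : ℝ) ^ (sumFreeDensity G * (Fintype.card G : ℝ))) ∧
        ((exceptionalSumFreeSets p k G).card : ℝ) ≤
          ε * (2 : ℝ) ^ (sumFreeDensity G * (Fintype.card G : ℝ)) := by
  have : Fact p.Prime := ⟨hp⟩
  obtain ⟨N₁, hN₁⟩ := exists_card_exceptionalSumFreeSets_le_mul hk (half_pos hε)
  obtain ⟨N₂, hN₂⟩ := exists_abs_card_biUnion_middlePreimages_sub_le hk (half_pos hε)
  refine ⟨max N₁ N₂, fun G _ _ hG hN => ?_⟩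
  classical
  specialize hN₁ G hG ((le_max_left _ _).trans hN)
  specialize hN₂ G hG ((le_max_right _ _).trans hN)
  have hone : (1 : ℝ) ≤ #(middlePreimages p k G) := by
    exact_mod_cast (hG.middlePreimages_nonempty (k := k)).card_pos
  rw [← card_middlePreimages hk, hG.card_sumFreeSets_eq_add hk, Nat.cast_add, add_sub_right_comm]
  set M : ℝ := 2 ^ (sumFreeDensity G * Fintype.card G)
  have hM : 0 < M := by positivity
  have hexc : (#(exceptionalSumFreeSets p k G) : ℝ) ≤ ε / 2 * (#(middlePreimages p k G) * M) :=
    hN₁.trans (by gcongr; exact le_mul_of_one_le_left hM.le hone)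
  refine ⟨(abs_add_le _ _).trans ?_, hN₁.trans (by gcongr; exact half_le_self hε.le)⟩
  rw [Nat.abs_cast]
  linarith
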